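/- Let $n\ge 1$ be an integer and let $C>1$. There is a constant $K\ge 1$, depending only on $C$ and $n$, such that the following holds. Let $M$ be a smooth $n$-manifold, let $F\colon TM\to[0,\infty)$ be a Finsler metric on $M$ (a continuous function, $C^\infty$ off the zero section, with $F(x,\lambda v)=\lambda F(x,v)$ for $\lambda>0$, $F(x,v)=0$ if and only if $v=0$, and positive definite vertical Hessian $\big(\partial^2F^2/\partial v_i\partial v_j\big)$ at every $v\neq 0$; $F$ need not be reversible), and let $g_0$ be a smooth Riemannian metric on $M$ such that $$C^{-1}\le \frac{F(x,v)}{\sqrt{g_0(v,v)}}\le C\qquad\text{for all }x\in M,\ 0\ne v\in T_xM .$$ Let $\pi\colon HM=(TM\smallsetminus 0)/\mathbb R_{>0}\to M$ be the bundle of rays; let $A$ be the Hilbert form of $F$, the $1$-form on $HM$ given by $A_{(x,[v])}(Z)=\frac{d}{d\varepsilon}\big|_{\varepsilon=0}F(x,v+\varepsilon\, d\pi(Z))$; let $X$ be its Reeb field ($A(X)=1$, $i_XdA=0$); and let $\Omega^F$ (a volume form on $M$, defined locally up to sign) and $\alpha^F$ (an $(n-1)$-form on $HM$, determined on vertical vectors)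 be given by $\alpha^F\wedge\pi^*\Omega^F=A\wedge (dA)^{n-1}$ and $\int_{H_xM}\alpha^F=\mathrm{vol}(\mathbb S^{n-1})$ for all $x\in M$. Let $$\Delta^Ff(x)=\frac{n}{\mathrm{vol}(\mathbb S^{n-1})}\int_{H_xM}L_X^2(\pi^*f)\,\alpha^F$$ be the Finsler--Laplacian of $F$, and let $\sigma^F$ be its symbol, i.e. the quadratic form on $T^*M$ given by $\sigma^F_x(p,p)=\tfrac12\Delta^F(\varphi^2)(x)$ for any function $\varphi$ that is smooth near $x$ with $\varphi(x)=0$ and $d\varphi_x=p$. Write $\lVert p\rVert_{\sigma^F}=\sqrt{\sigma^F_x(p,p)}$ and $\lVert p\rVert_{g_0^*}=\sup\{p(v)\mid v\in T_xM,\ g_0(v,v)=1\}$. Then $\sigma^F$ is well defined and, for all $x\in M$ and all $0\ne p\in T_x^*M$, $$C^{-K}\le\frac{\lVert p\rVert_{\sigma^F}}{\lVert p\rVert_{g_0^*}}\le C^{K}.$$ -/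

import Mathlib

open scoped Manifold ContDiff Topology

noncomputable section

namespace Finsler

/-- The model space `ℝⁿ` with `n = d + 1`. -/
abbrev E (d : ℕ) : Type := EuclideanSpace ℝ (Fin (d + 1))

/-! ### Multilinear algebra -/

section Algebra

variable {V : Type*} [AddCommGroup V] [Module ℝ V]

/-- The wedge product of a `k`-form and an `l`-form:
`(a ∧ b)(W) = 1/(k! l!) ∑_σ sgn σ a(W_σ(1), …, W_σ(k)) b(W_σ(k+1), …, W_σ(k+l))`. -/
def wedge {k l : ℕ} (a : V [⋀^Fin k]→ₗ[ℝ] ℝ) (b : V [⋀^Fin l]→ₗ[ℝ] ℝ)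
    (W : Fin (k + l) → V) : ℝ :=
  ((k.factorial : ℝ) * (l.factorial : ℝ))⁻¹ * ∑ σ : Equiv.Perm (Fin (k + l)),
    ((Equiv.Perm.sign σ : ℤ) : ℝ) *
      (a (fun i => W (σ (Fin.castAdd l i))) * b (fun j => W (σ (Fin.natAdd k j))))

/-- The `(2d+1)`-form `θ ∧ η ∧ ⋯ ∧ η` (`d` factors `η`) of a `1`-form `θ` and a `2`-form `η`:
`(θ ∧ η^d)(W) = 1/2^d ∑_σ sgn σ θ(W_σ(0)) η(W_σ(1), W_σ(2)) ⋯ η(W_σ(2d-1), W_σ(2d))`. -/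
def wedgeOnePowTwo (d : ℕ) (θ : V →ₗ[ℝ] ℝ) (η : V [⋀^Fin 2]→ₗ[ℝ] ℝ)
    (W : Fin (d + (d + 1)) → V) : ℝ :=
  ((2 : ℝ) ^ d)⁻¹ * ∑ σ : Equiv.Perm (Fin (d + (d + 1))),
    ((Equiv.Perm.sign σ : ℤ) : ℝ) *
      (θ (W (σ ⟨0, by omega⟩)) * ∏ i : Fin d,
        η ![W (σ ⟨2 * (i : ℕ) + 1, by omega⟩), W (σ ⟨2 * (i : ℕ) + 2, by omega⟩)])

end Algebra

/-! ### Finsler metrics and the Finsler-Laplacian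

`M` is a smooth manifold of dimension `n = d + 1`, `TM` its tangent bundle, `T°M ⊆ TM` the set of
non-zero vectors, `HM = T°M / ℝ₊` the homogenized bundle and `r : T°M → HM` the projection. Objects
on `HM` are represented by their pull-backs under `r`: functions on `HM` are the functions on `T°M`
which are homogeneous of degree `0`, forms on `HM` are represented by their pull-backs to `T°M`,
and a vector field on `HM` by a lift to `T°M` (which is unique up to the radial direction `ker dr`,
along which pull-backs from `HM` do not vary). -/

variable {d : ℕ} {M : Type*} [TopologicalSpace M] [ChartedSpace (E d) M]
  [IsManifold (𝓡 (d + 1)) ∞ M]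

/-- A (smooth) Finsler metric on `M`. Positivity of the quadratic form
`w ↦ d²/dt² F²(x, v + t w)` at `t = 0` says that the vertical Hessian of `F²` at `(x, v)` is
positive definite. -/
structure IsFinslerMetric (F : TangentBundle (𝓡 (d + 1)) M → ℝ) : Prop where
  continuous : Continuous F
  smooth : ContMDiffOn (𝓡 (d + 1)).tangent 𝓘(ℝ, ℝ) ∞ F {q | q.2 ≠ 0}
  homogeneous : ∀ (x : M) (v : TangentSpace (𝓡 (d + 1)) x) (c : ℝ), 0 < c →
    F ⟨x, c • v⟩ = c * F ⟨x, v⟩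
  nonneg : ∀ q, 0 ≤ F q
  eq_zero_iff : ∀ (x : M) (v : TangentSpace (𝓡 (d + 1)) x), F ⟨x, v⟩ = 0 ↔ v = 0
  stronglyConvex : ∀ (x : M) (v w : TangentSpace (𝓡 (d + 1)) x), v ≠ 0 → w ≠ 0 →
    0 < iteratedDeriv 2 (fun t : ℝ => F ⟨x, v + t • w⟩ ^ 2) 0

/-- The differential at `q` of the projection `TM → M`. -/
def dproj (q : TangentBundle (𝓡 (d + 1)) M) :
    TangentSpace (𝓡 (d + 1)).tangent q →L[ℝ] TangentSpace (𝓡 (d + 1)) q.1 :=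
  mfderiv (𝓡 (d + 1)).tangent (𝓡 (d + 1))
    (fun q' : TangentBundle (𝓡 (d + 1)) M => q'.1) q

/-- The vertical vector of `T_{(x,v)}TM` that corresponds to `u ∈ T_xM`. -/
def verticalLift (x : M) (v : E d) : E d →L[ℝ] TangentSpace (𝓡 (d + 1)).tangent
    (⟨x, v⟩ : TangentBundle (𝓡 (d + 1)) M) :=
  mfderiv 𝓘(ℝ, E d) (𝓡 (d + 1)).tangent
    (fun u : E d => (⟨x, u⟩ : TangentBundle (𝓡 (d + 1)) M)) v

/-- The Hilbert form `A_{(x,v)}(Z) = d/dε F(x, v + ε dπ(Z))` at `ε = 0`. -/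
def hilbertForm (F : TangentBundle (𝓡 (d + 1)) M → ℝ) (q : TangentBundle (𝓡 (d + 1)) M) :
    TangentSpace (𝓡 (d + 1)).tangent q →L[ℝ] ℝ :=
  (fderiv ℝ (fun u : E d => F ⟨q.1, u⟩) q.2).comp (dproj q)

/-- The exterior derivative at `q` of a `1`-form on the manifold `TM`: the exterior derivative of
the expression of the form in the preferred chart at `q`. (The tangent space at `q` is, by
definition, the model space via this chart.) -/
def extDerivOneForm
    (θ : ∀ q : TangentBundle (𝓡 (d + 1)) M, TangentSpace (𝓡 (d + 1)).tangent q →L[ℝ] ℝ)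
    (q : TangentBundle (𝓡 (d + 1)) M) :
    TangentSpace (𝓡 (d + 1)).tangent q [⋀^Fin 2]→L[ℝ] ℝ :=
  extDeriv (fun z : E d × E d => ContinuousAlternatingMap.ofSubsingleton ℝ (E d × E d) ℝ (0 : Fin 1)
    ((θ ((extChartAt (𝓡 (d + 1)).tangent q).symm z)).comp
      (mfderiv 𝓘(ℝ, E d × E d) (𝓡 (d + 1)).tangent
        (extChartAt (𝓡 (d + 1)).tangent q).symm z)))
    (extChartAt (𝓡 (d + 1)).tangent q q)

/-- `Z ∈ T_q TM` is a lift of the Reeb field of the Hilbert form: `A(Z) = 1` and `i_Z dA = 0`. -/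
def IsReebVector (F : TangentBundle (𝓡 (d + 1)) M → ℝ) (q : TangentBundle (𝓡 (d + 1)) M)
    (Z : TangentSpace (𝓡 (d + 1)).tangent q) : Prop :=
  hilbertForm F q Z = 1 ∧
    ∀ W : TangentSpace (𝓡 (d + 1)).tangent q, extDerivOneForm (hilbertForm F) q ![Z, W] = 0

/-- The Reeb field `X` of the Hilbert form, i.e. the geodesic field of `F`. -/
def reebField (F : TangentBundle (𝓡 (d + 1)) M → ℝ) (q : TangentBundle (𝓡 (d + 1)) M) :
    TangentSpace (𝓡 (d + 1)).tangent q :=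
  Classical.epsilon (IsReebVector F q)

/-- The Lie derivative `L_X h` of a function `h` along the Reeb field `X`. -/
def lieReeb (F h : TangentBundle (𝓡 (d + 1)) M → ℝ) (q : TangentBundle (𝓡 (d + 1)) M) : ℝ :=
  mfderiv (𝓡 (d + 1)).tangent 𝓘(ℝ, ℝ) h q (reebField F q)

/-- The canonical `(2n-1)`-form `A ∧ (dA)^{n-1}`. -/
def contactForm (F : TangentBundle (𝓡 (d + 1)) M → ℝ) (q : TangentBundle (𝓡 (d + 1)) M)
    (W : Fin (d + (d + 1)) → TangentSpace (𝓡 (d + 1)).tangent q) : ℝ :=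
  wedgeOnePowTwo d (hilbertForm F q).toLinearMap
    (extDerivOneForm (hilbertForm F) q).toAlternatingMap W

/-- The Euclidean volume of the unit sphere `S^{n-1}`. -/
def sphereVolume (d : ℕ) : ℝ :=
  ((MeasureTheory.volume : MeasureTheory.Measure (E d)).toSphere).real Set.univ

/-- For an `(n-1)`-form `β` on `ℝⁿ` and a unit vector `s`, the number `c` such that on `s^⊥` one has
`β = c · vol`, where `vol` is the Euclidean area form of the unit sphere at `s`, oriented by the
outward normal: `c = ∑_j (-1)^j s_j β(e_0, …, ê_j, …, e_{n-1})`. -/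
def sphereDensity (β : (Fin d → E d) → ℝ) (s : E d) : ℝ :=
  ∑ j : Fin (d + 1), (-1 : ℝ) ^ (j : ℕ) * s j *
    β (fun i => EuclideanSpace.single (j.succAbove i) (1 : ℝ))

/-- The integral `∫_{H_xM} h α` of an `(n-1)`-form `h α`: the fiber `H_xM` of rays in `T_xM` is
parametrized by the unit sphere of `T_xM ≅ ℝⁿ` (any other star-shaped hypersurface gives the same
value when `h` is homogeneous of degree `0` and `α` comes from `HM`), with its outward orientation,
and `h α` is restricted to it. -/
def fiberIntegral (x : M) (h : TangentBundle (𝓡 (d + 1)) M → ℝ)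
    (α : ∀ v : E d, TangentSpace (𝓡 (d + 1)).tangent (⟨x, v⟩ : TangentBundle (𝓡 (d + 1)) M)
      [⋀^Fin d]→ₗ[ℝ] ℝ) : ℝ :=
  ∫ s : Metric.sphere (0 : E d) 1,
    h ⟨x, (s : E d)⟩ *
      sphereDensity (fun u => α (s : E d) (fun i => verticalLift x (s : E d) (u i))) (s : E d)
    ∂((MeasureTheory.volume : MeasureTheory.Measure (E d)).toSphere)

/-- The volume element `Ω = Ω^F` at `x` and the angle form `α = α^F` on the fiber over `x`:
`α ∧ π^*Ω = A ∧ (dA)^{n-1}` and `∫_{H_xM} α = vol(S^{n-1})`. These two conditions determine `Ω` and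
the restriction of `α` to vertical vectors; the latter is then automatically the pull-back of a
nowhere zero form on `H_xM`. -/
structure IsVolumeAngle (F : TangentBundle (𝓡 (d + 1)) M → ℝ) (x : M)
    (Ω : TangentSpace (𝓡 (d + 1)) x [⋀^Fin (d + 1)]→ₗ[ℝ] ℝ)
    (α : ∀ v : E d, TangentSpace (𝓡 (d + 1)).tangent (⟨x, v⟩ : TangentBundle (𝓡 (d + 1)) M)
      [⋀^Fin d]→ₗ[ℝ] ℝ) : Prop where
  volume_ne_zero : Ω ≠ 0
  wedge_eq : ∀ v : E d, v ≠ 0 →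
    ∀ W : Fin (d + (d + 1)) →
        TangentSpace (𝓡 (d + 1)).tangent (⟨x, v⟩ : TangentBundle (𝓡 (d + 1)) M),
      wedge (α v) (Ω.compLinearMap (dproj (⟨x, v⟩ : TangentBundle (𝓡 (d + 1)) M)).toLinearMap) W
        = contactForm F ⟨x, v⟩ W
  integral_eq : fiberIntegral x (fun _ => 1) α = sphereVolume d

/-- The angle form `α^F` on the fiber over `x`. -/
def angleForm (F : TangentBundle (𝓡 (d + 1)) M → ℝ) (x : M) :
    ∀ v : E d, TangentSpace (𝓡 (d + 1)).tangent (⟨x, v⟩ : TangentBundle (𝓡 (d + 1)) M)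
      [⋀^Fin d]→ₗ[ℝ] ℝ :=
  Classical.epsilon (fun α => ∃ Ω, IsVolumeAngle F x Ω α)

/-- The Finsler-Laplacian
`Δ^F f (x) = n / vol(S^{n-1}) ∫_{H_xM} L_X² (π^*f) α^F`. -/
def finslerLaplacian (F : TangentBundle (𝓡 (d + 1)) M → ℝ) (f : M → ℝ) (x : M) : ℝ :=
  ((d + 1 : ℕ) : ℝ) / sphereVolume d *
    fiberIntegral x
      (lieReeb F (lieReeb F (fun q : TangentBundle (𝓡 (d + 1)) M => f q.1)))
      (angleForm F x)

/-! ### The symbol and the dual norm -/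

/-- `σ` is the (principal) symbol, as a function `p ↦ σ(p, p)` on `T^*M`, of the second order linear
differential operator `P`: one has `σ_x(dφ_x, dφ_x) = ½ P(φ²)(x)` for every function `φ` which is
smooth near `x` and vanishes at `x`. In local coordinates, if
`P = ∑ a^{ij} ∂_i ∂_j + ∑ b^i ∂_i + c` with `a` symmetric, this means
`σ_x(p, p) = ∑ a^{ij}(x) p_i p_j`. -/
def IsSymbol (P : (M → ℝ) → M → ℝ)
    (σ : ∀ x : M, (TangentSpace (𝓡 (d + 1)) x →L[ℝ] ℝ) → ℝ) : Prop :=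
  ∀ (x : M) (φ : M → ℝ), ContMDiffAt (𝓡 (d + 1)) 𝓘(ℝ, ℝ) ∞ φ x → φ x = 0 →
    σ x (mfderiv (𝓡 (d + 1)) 𝓘(ℝ, ℝ) φ x) = 1 / 2 * P (fun y => φ y ^ 2) x

/-- An operator has at most one symbol. -/
theorem IsSymbol.unique {P : (M → ℝ) → M → ℝ}
    {σ τ : ∀ x : M, (TangentSpace (𝓡 (d + 1)) x →L[ℝ] ℝ) → ℝ}
    (hσ : IsSymbol P σ) (hτ : IsSymbol P τ) : σ = τ := by
  funext x p
  have hφ : ∃ φ : M → ℝ, ContMDiffAt (𝓡 (d + 1)) 𝓘(ℝ, ℝ) ∞ φ x ∧ φ x = 0 ∧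
      mfderiv (𝓡 (d + 1)) 𝓘(ℝ, ℝ) φ x = p := by
    let p' : E d →L[ℝ] ℝ := p
    let ψ : E d → ℝ := fun z => p' z - p' (extChartAt (𝓡 (d + 1)) x x)
    have hψ : ContDiff ℝ ∞ ψ := by fun_prop
    have hc : ContMDiffAt (𝓡 (d + 1)) 𝓘(ℝ, ℝ) ∞ (ψ ∘ extChartAt (𝓡 (d + 1)) x) x :=
      hψ.contMDiff.contMDiffAt.comp x contMDiffAt_extChartAt
    refine ⟨_, hc, by simp [ψ], ?_⟩
    rw [(hc.mdifferentiableAt (by simp)).mfderiv]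
    have he : writtenInExtChartAt (𝓡 (d + 1)) 𝓘(ℝ, ℝ) x (ψ ∘ extChartAt (𝓡 (d + 1)) x)
        =ᶠ[𝓝 (extChartAt (𝓡 (d + 1)) x x)] ψ := by
      filter_upwards [extChartAt_target_mem_nhds (I := 𝓡 (d + 1)) x] with z hz
      simp only [writtenInExtChartAt, Function.comp, extChartAt_model_space_eq_id,
        PartialEquiv.refl_coe, id]
      rw [(extChartAt (𝓡 (d + 1)) x).right_inv hz]
    simp only [ModelWithCorners.range_eq_univ, fderivWithin_univ]
    rw [he.fderiv_eq]
    exact (p'.hasFDerivAt.sub_const _).fderiv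
  obtain ⟨φ, h1, h2, rfl⟩ := hφ
  rw [hσ x φ h1 h2, hτ x φ h1 h2]

/-- The norm on `T_x^*M` dual to the Riemannian metric `g`. -/
def dualNorm (g : Bundle.ContMDiffRiemannianMetric (𝓡 (d + 1)) ∞ (E d)
    (fun x : M => TangentSpace (𝓡 (d + 1)) x)) (x : M)
    (p : TangentSpace (𝓡 (d + 1)) x →L[ℝ] ℝ) : ℝ :=
  sSup {t : ℝ | ∃ v : TangentSpace (𝓡 (d + 1)) x, g.inner x v v = 1 ∧ t = p v}

end Finsler

end

/-!
At a point `x` the symbol of `Δ^F` is `n` times the average of `(p v / F v) ^ 2` over the rays `[v]`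
with respect to the angle form. On the Euclidean unit sphere of a chart the angle form has, up to a
constant, the Jacobian of the map `v ↦ ‖v‖ • dF_v` as its density. This map is a bijection of the
Euclidean unit ball onto the unit ball of the dual norm of `F`, up to the origins, so averages over
rays become averages over the dual unit ball. Since `|p v| ≤ C ‖p‖ F v`, the symbol is at most
`n C ^ 2 ‖p‖ ^ 2`. For the lower bound one keeps only the contribution of a small dual ball centred
on the ray through `p`: there `p v / F v` is bounded below, and the relative volume of the small
ball is bounded below by scaling.
-/

noncomputable section

namespace Finsler

/-! ### Wedge products -/

section SignedSum

open Equiv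

variable {R ι κ : Type*} [CommRing R] [Fintype ι] [DecidableEq ι]

/-- The alternating sum `∑_σ sgn σ G(σ)` over a symmetric group. -/
def signedSum (G : Perm ι → R) : R := ∑ σ : Perm ι, ((Perm.sign σ : ℤ) : R) * G σ

theorem sign_mul_self_cast (σ : Perm ι) :
    ((Perm.sign σ : ℤ) : R) * ((Perm.sign σ : ℤ) : R) = 1 := by
  rw [← Int.cast_mul, Int.units_coe_mul_self, Int.cast_one]

theorem signedSum_mul_right (τ : Perm ι) (G : Perm ι → R) :
    signedSum (fun σ => G (σ * τ)) = ((Perm.sign τ : ℤ) : R) * signedSum G := by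
  rw [signedSum, signedSum, Finset.mul_sum]
  refine Fintype.sum_equiv (Equiv.mulRight τ) _ _ fun σ => ?_
  simp only [Equiv.coe_mulRight, Perm.sign_mul, Units.val_mul, Int.cast_mul]
  linear_combination (-((Perm.sign σ : ℤ) : R) * G (σ * τ)) * sign_mul_self_cast (R := R) τ

theorem signedSum_mul_sub_swap {i j : ι} (hij : i ≠ j) (z : Perm ι → R)
    (hz : ∀ σ, z (σ * swap i j) = z σ) (c : ι → ι → R) :
    signedSum (fun σ => z σ * (c (σ i) (σ j) - c (σ j) (σ i))) =
      2 * signedSum (fun σ => z σ * c (σ i) (σ j)) := by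
  have hswap : signedSum (fun σ => z σ * c (σ j) (σ i)) =
      -signedSum (fun σ => z σ * c (σ i) (σ j)) := by
    have := signedSum_mul_right (swap i j) fun σ => z σ * c (σ i) (σ j)
    simpa [hz, Perm.sign_swap hij] using this
  have hsub : signedSum (fun σ => z σ * (c (σ i) (σ j) - c (σ j) (σ i))) =
      signedSum (fun σ => z σ * c (σ i) (σ j)) - signedSum (fun σ => z σ * c (σ j) (σ i)) := by
    simp only [signedSum, mul_sub, Finset.sum_sub_distrib]
  rw [hsub, hswap]
  ring

theorem signedSum_mul_prod_sub_swap (S : Finset κ) {l r : κ → ι} (hl : Function.Injective l)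
    (hr : Function.Injective r) (hlr : ∀ i j, l i ≠ r j) (z : Perm ι → R)
    (hz : ∀ i ∈ S, ∀ σ, z (σ * swap (l i) (r i)) = z σ) (c : ι → ι → R) :
    signedSum (fun σ => z σ * ∏ i ∈ S, (c (σ (l i)) (σ (r i)) - c (σ (r i)) (σ (l i)))) =
      2 ^ S.card * signedSum (fun σ => z σ * ∏ i ∈ S, c (σ (l i)) (σ (r i))) := by
  classical
  induction S using Finset.induction_on generalizing z with
  | empty => simp
  | insert i S hi ih =>
    have hfix : ∀ {j k}, j ≠ k →
        swap (l j) (r j) (l k) = l k ∧ swap (l j) (r j) (r k) = r k := fun h =>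
      ⟨swap_apply_of_ne_of_ne (hl.ne h.symm) (hlr _ _),
        swap_apply_of_ne_of_ne (hlr _ _).symm (hr.ne h.symm)⟩
    have hne : ∀ {j}, j ∈ S → j ≠ i := fun hj h => hi (h ▸ hj)
    have hpairs := ih (fun σ => z σ * (c (σ (l i)) (σ (r i)) - c (σ (r i)) (σ (l i))))
      fun j hj σ => by
        simp only [hz j (Finset.mem_insert_of_mem hj), Perm.mul_apply, (hfix (hne hj)).1,
          (hfix (hne hj)).2]
    have hpair := signedSum_mul_sub_swap (hlr i i)
      (fun σ => z σ * ∏ j ∈ S, c (σ (l j)) (σ (r j))) (fun σ => by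
        simp only [hz i (Finset.mem_insert_self i S), Perm.mul_apply]
        congr 1
        refine Finset.prod_congr rfl fun j hj => ?_
        rw [(hfix (hne hj).symm).1, (hfix (hne hj).symm).2]) c
    simp only [Finset.prod_insert hi, Finset.card_insert_of_notMem hi, pow_succ,
      mul_assoc] at hpairs hpair ⊢
    simp only [mul_comm (∏ _j ∈ S, c _ _)] at hpair
    rw [hpairs, hpair]

end SignedSum

section Blocks

open Equiv

variable {k l : ℕ}

/-- The permutation acting by `τ` on the first block of indices and by `ρ` on the last one. -/
def permBlocks (τ : Perm (Fin k)) (ρ : Perm (Fin l)) : Perm (Fin (k + l)) :=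
  finSumFinEquiv.permCongr (Perm.sumCongr τ ρ)

theorem sign_permBlocks (τ : Perm (Fin k)) (ρ : Perm (Fin l)) :
    Perm.sign (permBlocks τ ρ) = Perm.sign τ * Perm.sign ρ := by
  rw [permBlocks, Perm.sign_permCongr, Perm.sign_sumCongr]

@[simp]
theorem permBlocks_castAdd (τ : Perm (Fin k)) (ρ : Perm (Fin l)) (i : Fin k) :
    permBlocks τ ρ (Fin.castAdd l i) = Fin.castAdd l (τ i) := by
  simp [permBlocks, Equiv.permCongr_apply]

@[simp]
theorem permBlocks_natAdd (τ : Perm (Fin k)) (ρ : Perm (Fin l)) (j : Fin l) :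
    permBlocks τ ρ (Fin.natAdd k j) = Fin.natAdd k (ρ j) := by
  simp [permBlocks, Equiv.permCongr_apply]

theorem permBlocks_injective : Function.Injective
    fun p : Perm (Fin k) × Perm (Fin l) => permBlocks p.1 p.2 :=
  finSumFinEquiv.permCongr.injective.comp Perm.sumCongrHom_injective

theorem exists_permBlocks_eq {σ : Perm (Fin (k + l))}
    (h : ∀ j, ∃ j', σ (Fin.natAdd k j) = Fin.natAdd k j') :
    ∃ p : Perm (Fin k) × Perm (Fin l), permBlocks p.1 p.2 = σ := by
  have hinr : Set.MapsTo (finSumFinEquiv.symm.permCongr σ) (Set.range Sum.inr)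
      (Set.range (Sum.inr : Fin l → Fin k ⊕ Fin l)) := by
    rintro _ ⟨j, rfl⟩
    obtain ⟨j', hj'⟩ := h j
    exact ⟨j', by simp [Equiv.permCongr_apply, hj']⟩
  obtain ⟨p, hp⟩ := Perm.mem_sumCongrHom_range_of_perm_mapsTo_inl
    ((Perm.perm_mapsTo_inl_iff_mapsTo_inr _).2 hinr)
  refine ⟨p, ?_⟩
  rw [permBlocks, ← Perm.sumCongrHom_apply, hp]
  ext i
  simp [Equiv.permCongr_apply]

theorem factorial_mul_signedSum_prod_dotProduct {R : Type*} [CommRing R]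
    (X : Perm (Fin (k + l)) → Matrix (Fin l) (Fin l) R)
    (hX : ∀ σ ρ, X (σ * permBlocks 1 ρ) = X σ) (y : Fin (k + l) → Fin l → R) :
    (l.factorial : R) * signedSum (fun σ => ∏ j, X σ j ⬝ᵥ y (σ (Fin.natAdd k j))) =
      signedSum (fun σ => (X σ).det * (Matrix.of fun j => y (σ (Fin.natAdd k j))).det) := by
  set P : Perm (Fin (k + l)) → R := fun σ => ∏ j, X σ j ⬝ᵥ y (σ (Fin.natAdd k j)) with hP
  have hdet : ∀ σ, (X σ).det * (Matrix.of fun j => y (σ (Fin.natAdd k j))).det =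
      signedSum fun ρ => P (σ * permBlocks 1 ρ) := by
    intro σ
    rw [← Matrix.det_transpose (Matrix.of _), ← Matrix.det_mul, ← Matrix.det_transpose,
      Matrix.det_apply', signedSum]
    simp only [hP, hX, Perm.mul_apply, permBlocks_natAdd]
    rfl
  calc (l.factorial : R) * signedSum P
      = ∑ ρ : Perm (Fin l), ((Perm.sign ρ : ℤ) : R) *
          signedSum (fun σ => P (σ * permBlocks 1 ρ)) := by
        simp only [signedSum_mul_right, sign_permBlocks, Perm.sign_one, one_mul, ← mul_assoc,
          sign_mul_self_cast]
        simp [Fintype.card_perm]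
    _ = signedSum (fun σ => (X σ).det * (Matrix.of fun j => y (σ (Fin.natAdd k j))).det) := by
        simp only [hdet]
        simp only [signedSum, Finset.mul_sum]
        rw [Finset.sum_comm]
        simp only [mul_left_comm]

end Blocks

section Wedge

open Equiv

variable {V : Type*} [AddCommGroup V] [Module ℝ V]

theorem wedge_append {k l : ℕ} (α : V [⋀^Fin k]→ₗ[ℝ] ℝ) (γ : V [⋀^Fin l]→ₗ[ℝ] ℝ)
    (u : Fin k → V) (w : Fin l → V) (h : ∀ (Y : Fin l → V) i j, Y j = u i → γ Y = 0) :
    wedge α γ (Fin.append u w) = α u * γ w := by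
  set T : Perm (Fin (k + l)) → ℝ := fun σ => ((Perm.sign σ : ℤ) : ℝ) *
    (α (fun i => Fin.append u w (σ (Fin.castAdd l i))) *
      γ (fun j => Fin.append u w (σ (Fin.natAdd k j)))) with hT
  have hblocks : ∀ p : Perm (Fin k) × Perm (Fin l), T (permBlocks p.1 p.2) = α u * γ w := by
    rintro ⟨τ, ρ⟩
    have hα : α (fun i => u (τ i)) = ((Perm.sign τ : ℤ) : ℝ) * α u := by
      simpa [Units.smul_def, Function.comp_def] using α.map_perm u τ
    have hγ : γ (fun j => w (ρ j)) = ((Perm.sign ρ : ℤ) : ℝ) * γ w := by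
      simpa [Units.smul_def, Function.comp_def] using γ.map_perm w ρ
    simp only [hT, permBlocks_castAdd, permBlocks_natAdd, Fin.append_left, Fin.append_right,
      sign_permBlocks, hα, hγ, Units.val_mul, Int.cast_mul]
    linear_combination (α u * γ w) * (sign_mul_self_cast (R := ℝ) ρ +
      ((Perm.sign ρ : ℤ) : ℝ) ^ 2 * sign_mul_self_cast (R := ℝ) τ)
  have hother : ∀ σ, σ ∉ Set.range (fun p : Perm (Fin k) × Perm (Fin l) => permBlocks p.1 p.2) →
      T σ = 0 := by
    intro σ hσ
    obtain ⟨j, hj⟩ := not_forall.1 fun hall => hσ (exists_permBlocks_eq hall)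
    obtain ⟨i, hi⟩ : ∃ i, σ (Fin.natAdd k j) = Fin.castAdd l i := by
      induction hm : σ (Fin.natAdd k j) using Fin.addCases with
      | left i => exact ⟨i, rfl⟩
      | right j' => exact absurd ⟨j', hm⟩ hj
    have hγ : γ (fun j => Fin.append u w (σ (Fin.natAdd k j))) = 0 :=
      h _ i j (by rw [hi, Fin.append_left])
    simp only [hT, hγ, mul_zero]
  have hsum : ∑ σ, T σ = (k.factorial : ℝ) * l.factorial * (α u * γ w) := by
    rw [← Fintype.sum_of_injective _ permBlocks_injective _ T hother fun p => (hblocks p).symm]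
    simp [Fintype.card_perm]
  rw [wedge, hsum, inv_mul_cancel_left₀ (by positivity)]

theorem wedge_smul_compLinearMap_smul {V' : Type*} [AddCommGroup V'] [Module ℝ V'] {k l : ℕ}
    (a b : ℝ) (α : V [⋀^Fin k]→ₗ[ℝ] ℝ) (γ : V' [⋀^Fin l]→ₗ[ℝ] ℝ) (π : V →ₗ[ℝ] V')
    (W : Fin (k + l) → V) :
    wedge (a • α) ((b • γ).compLinearMap π) W = a * b * wedge α (γ.compLinearMap π) W := by
  simp only [wedge, AlternatingMap.smul_apply, AlternatingMap.compLinearMap_apply, smul_eq_mul,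
    Finset.mul_sum]
  exact Finset.sum_congr rfl fun σ _ => by ring

/-- The bijection that lists the odd indices `2i + 1` first and the even indices `2j` last: it turns
the index pattern of `wedge` into that of `wedgeOnePowTwo`. -/
def interleave (d : ℕ) : Fin d ⊕ Fin (d + 1) ≃ Fin (d + (d + 1)) :=
  Equiv.ofBijective
    (Sum.elim (fun i => ⟨2 * (i : ℕ) + 1, by omega⟩) (fun j => ⟨2 * (j : ℕ), by omega⟩)) <| by
    rw [Fintype.bijective_iff_injective_and_card]
    refine ⟨?_, by simp⟩
    rintro (i | i) (j | j) h <;>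
      simp only [Sum.elim_inl, Sum.elim_inr, Sum.inl.injEq, Sum.inr.injEq,
        reduceCtorEq, Fin.ext_iff] at h ⊢ <;> omega

/-- The permutation that turns the block order of the indices into the interleaved order. -/
def shuffle (d : ℕ) : Perm (Fin (d + (d + 1))) := finSumFinEquiv.symm.trans (interleave d)

theorem shuffle_castAdd {d : ℕ} (i : Fin d) :
    shuffle d (Fin.castAdd (d + 1) i) = interleave d (Sum.inl i) := by
  simp [shuffle]

theorem shuffle_natAdd {d : ℕ} (j : Fin (d + 1)) :
    shuffle d (Fin.natAdd d j) = interleave d (Sum.inr j) := by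
  simp [shuffle]

/-- The `d`-form `U ↦ det (a, b U₁, …, b U_d)`. -/
def borderedDet {d : ℕ} (a : Fin (d + 1) → ℝ) (b : V →ₗ[ℝ] (Fin (d + 1) → ℝ)) :
    V [⋀^Fin d]→ₗ[ℝ] ℝ :=
  ((Matrix.detRowAlternating : (Fin (d + 1) → ℝ) [⋀^Fin (d + 1)]→ₗ[ℝ] ℝ).curryLeft
    a).compLinearMap b

theorem borderedDet_apply {d : ℕ} (a : Fin (d + 1) → ℝ) (b : V →ₗ[ℝ] (Fin (d + 1) → ℝ))
    (U : Fin d → V) :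
    borderedDet a b U = Matrix.det (Matrix.of (Fin.cons a fun i => b (U i))) := rfl

variable {d : ℕ} {a : Fin (d + 1) → ℝ} {b π : V →ₗ[ℝ] (Fin (d + 1) → ℝ)} {θ : V →ₗ[ℝ] ℝ}
  {η : V [⋀^Fin 2]→ₗ[ℝ] ℝ} (hθ : ∀ Z, θ Z = a ⬝ᵥ π Z)
  (hη : ∀ Z Y, η ![Z, Y] = b Z ⬝ᵥ π Y - b Y ⬝ᵥ π Z)

include hθ hη

theorem wedgeOnePowTwo_eq_signedSum (W : Fin (d + (d + 1)) → V) :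
    wedgeOnePowTwo d θ η W = ((Perm.sign (shuffle d) : ℤ) : ℝ) *
      signedSum fun σ : Perm (Fin (d + (d + 1))) => (a ⬝ᵥ π (W (σ (Fin.natAdd d 0)))) *
        ∏ i : Fin d, b (W (σ (Fin.castAdd (d + 1) i))) ⬝ᵥ π (W (σ (Fin.natAdd d i.succ))) := by
  have hfix : ∀ i : Fin d, swap (interleave d (Sum.inl i)) (interleave d (Sum.inr i.succ))
      (interleave d (Sum.inr 0)) = interleave d (Sum.inr 0) := fun i =>
    swap_apply_of_ne_of_ne (by simp) (by simp [(Fin.succ_ne_zero i).symm])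
  have hpairs := signedSum_mul_prod_sub_swap Finset.univ (l := fun i => interleave d (Sum.inl i))
    (r := fun i => interleave d (Sum.inr i.succ)) (fun i j h => by simpa using h)
    (fun i j h => by simpa using h) (by simp)
    (fun σ => a ⬝ᵥ π (W (σ (interleave d (Sum.inr 0)))))
    (fun i _ σ => by simp only [Perm.mul_apply, hfix i]) fun m n => b (W m) ⬝ᵥ π (W n)
  have hdef : wedgeOnePowTwo d θ η W = ((2 : ℝ) ^ d)⁻¹ * signedSum fun σ =>
      (a ⬝ᵥ π (W (σ (interleave d (Sum.inr 0))))) * ∏ i : Fin d,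
        (b (W (σ (interleave d (Sum.inl i)))) ⬝ᵥ π (W (σ (interleave d (Sum.inr i.succ)))) -
          b (W (σ (interleave d (Sum.inr i.succ)))) ⬝ᵥ π (W (σ (interleave d (Sum.inl i))))) := by
    simp only [wedgeOnePowTwo, hθ, hη]
    rfl
  rw [hdef, hpairs, Finset.card_univ, Fintype.card_fin, inv_mul_cancel_left₀ (by positivity),
    ← signedSum_mul_right]
  simp only [Perm.mul_apply, shuffle_castAdd, shuffle_natAdd]

theorem wedgeOnePowTwo_eq_wedge (W : Fin (d + (d + 1)) → V) :
    wedgeOnePowTwo d θ η W = ((Perm.sign (shuffle d) : ℤ) : ℝ) * d.factorial *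
      wedge (borderedDet a b) (Matrix.detRowAlternating.compLinearMap π) W := by
  have hblock := factorial_mul_signedSum_prod_dotProduct (k := d) (l := d + 1)
    (fun σ => Matrix.of (Fin.cons a fun i => b (W (σ (Fin.castAdd (d + 1) i)))))
    (fun σ ρ => by simp only [Perm.mul_apply, permBlocks_castAdd, Perm.one_apply])
    fun m => π (W m)
  simp only [Fin.prod_univ_succ] at hblock
  have hwedge : wedge (borderedDet a b) (Matrix.detRowAlternating.compLinearMap π) W =
      ((d.factorial : ℝ) * (d + 1).factorial)⁻¹ * signedSum fun σ : Perm (Fin (d + (d + 1))) =>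
        (Matrix.of (Fin.cons a fun i => b (W (σ (Fin.castAdd (d + 1) i))))).det *
          (Matrix.of fun j => π (W (σ (Fin.natAdd d j)))).det := rfl
  rw [hwedge, ← hblock, wedgeOnePowTwo_eq_signedSum hθ hη W]
  have h0 : (d.factorial : ℝ) ≠ 0 := by positivity
  have h1 : ((d + 1).factorial : ℝ) ≠ 0 := by positivity
  field_simp
  rfl

end Wedge

/-! ### Rank one perturbations of a singular matrix -/

section Determinant

open Matrix

variable {R : Type*} [CommRing R]

theorem det_bordered {m : ℕ} (H : Matrix (Fin m) (Fin m) R) (s a : Fin m → R) :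
    (of (Fin.cons (Fin.cons (-1) a) fun i => Fin.cons (s i) (H i)) :
      Matrix (Fin (m + 1)) (Fin (m + 1)) R).det = -(H + vecMulVec s a).det := by
  have hreduced : (of (Fin.cons (Fin.cons (-1) a) fun i => Fin.cons 0 ((H + vecMulVec s a) i)) :
      Matrix (Fin (m + 1)) (Fin (m + 1)) R).det = -(H + vecMulVec s a).det := by
    rw [det_succ_column_zero, Fin.sum_univ_succ]
    simp only [of_apply, Fin.cons_zero, Fin.cons_succ, mul_zero, zero_mul, Finset.sum_const_zero,
      add_zero, Fin.val_zero, pow_zero, one_mul, neg_one_mul]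
    rfl
  rw [← hreduced]
  refine (det_eq_of_forall_row_eq_smul_add_const (Fin.cons 0 s) 0 rfl fun i j => ?_).symm
  cases i using Fin.cases <;> cases j using Fin.cases <;> simp [vecMulVec_apply]

theorem sum_mul_det_cons_succAbove {m : ℕ} (H : Matrix (Fin (m + 1)) (Fin (m + 1)) R)
    (hH : H.det = 0) (s a : Fin (m + 1) → R) :
    ∑ j : Fin (m + 1), (-1 : R) ^ (j : ℕ) * s j *
      (of (Fin.cons a fun i => H (j.succAbove i))).det = (H + vecMulVec s a).det := by
  set B : Matrix (Fin (m + 2)) (Fin (m + 2)) R :=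
    of (Fin.cons (Fin.cons (-1) a) fun i => Fin.cons (s i) (H i)) with hB
  have hminor : B.submatrix (Fin.succAbove 0) Fin.succ = H := by
    ext i j
    simp [hB]
  have hminor_succ (j : Fin (m + 1)) : B.submatrix j.succ.succAbove Fin.succ =
      of (Fin.cons a fun i => H (j.succAbove i)) := by
    ext i k
    cases i using Fin.cases <;> simp [hB]
  have hexpand := det_succ_column_zero B
  rw [det_bordered, Fin.sum_univ_succ, hminor, hH, mul_zero, zero_add] at hexpand
  rw [← neg_inj, hexpand, ← Finset.sum_neg_distrib]
  refine Finset.sum_congr rfl fun j _ => ?_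
  rw [hminor_succ]
  simp [hB, pow_succ]

theorem det_add_vecMulVec_of_mulVec_eq_zero {n : Type*} [Fintype n] [DecidableEq n]
    (H : Matrix n n R) (a : n → R) {s : n → R} (hH : H *ᵥ s = 0) (hs : s ⬝ᵥ s = 1) :
    (H + vecMulVec s a).det = (a ⬝ᵥ s) * (H + vecMulVec s s).det := by
  have hfactor : H + vecMulVec s a =
      (H + vecMulVec s s) * (1 + replicateCol Unit s * replicateRow Unit (a - s)) := by
    rw [← vecMulVec_eq, mul_add, mul_one, add_mul, mul_vecMulVec, hH, vecMulVec_mul_vecMulVec, hs]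
    simp [vecMulVec_sub]
  rw [hfactor, det_mul, det_one_add_replicateCol_mul_replicateRow, sub_dotProduct, hs,
    add_sub_cancel, mul_comm]

end Determinant

/-! ### Minkowski norms -/

section Minkowski

variable {V : Type*} [NormedAddCommGroup V] [NormedSpace ℝ V]

/-- A Minkowski norm: a smooth and strongly convex norm which need not be reversible, such as the
restriction of a Finsler metric to a tangent space. -/
structure IsMinkowskiNorm (f : V → ℝ) : Prop where
  smooth : ContDiffOn ℝ ∞ f {0}ᶜ
  homogeneous : ∀ (v : V) (c : ℝ), 0 < c → f (c • v) = c * f v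
  pos : ∀ v, v ≠ 0 → 0 < f v
  stronglyConvex : ∀ v w, v ≠ 0 → w ≠ 0 → 0 < iteratedDeriv 2 (fun t : ℝ => f (v + t • w) ^ 2) 0

theorem hasDerivAt_add_smul (v w : V) (t : ℝ) : HasDerivAt (fun t : ℝ => v + t • w) w t := by
  simpa using ((hasDerivAt_id t).smul_const w).const_add v

namespace IsMinkowskiNorm

variable {f : V → ℝ} (hf : IsMinkowskiNorm f) {v w : V}
include hf

theorem contDiffAt (hv : v ≠ 0) : ContDiffAt ℝ ∞ f v :=
  hf.smooth.contDiffAt (isOpen_compl_singleton.mem_nhds hv)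

theorem differentiableAt (hv : v ≠ 0) : DifferentiableAt ℝ f v :=
  (hf.contDiffAt hv).differentiableAt (by simp)

theorem differentiableAt_fderiv (hv : v ≠ 0) : DifferentiableAt ℝ (fderiv ℝ f) v :=
  ((hf.contDiffAt hv).fderiv_right (m := ∞) (by simp)).differentiableAt (by simp)

theorem map_zero : f 0 = 0 := by
  have h := hf.homogeneous 0 2 two_pos
  rw [smul_zero] at h
  linarith

theorem nonneg (v : V) : 0 ≤ f v := by
  rcases eq_or_ne v 0 with rfl | hv
  · exact hf.map_zero.ge
  · exact (hf.pos v hv).le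

theorem fderiv_smul (v : V) {c : ℝ} (hc : 0 < c) : fderiv ℝ f (c • v) = fderiv ℝ f v := by
  have hcomp := fderiv_comp_smul (f := f) (x := v) c
  rw [show (fun x => f (c • x)) = c • f from funext fun x => hf.homogeneous x c hc,
    fderiv_const_smul_field] at hcomp
  exact (smul_right_injective _ hc.ne' hcomp).symm

theorem fderiv_self (hv : v ≠ 0) : fderiv ℝ f v v = f v := by
  have hd := (hf.differentiableAt hv).hasFDerivAt
  rw [← one_smul ℝ v] at hd
  have hray := hd.comp_hasDerivAt (1 : ℝ) ((hasDerivAt_id (1 : ℝ)).smul_const v)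
  simp only [one_smul] at hray
  refine hray.unique (((hasDerivAt_id (1 : ℝ)).mul_const (f v)).congr_deriv (one_mul _)
    |>.congr_of_eventuallyEq ?_)
  filter_upwards [lt_mem_nhds zero_lt_one] with t ht using hf.homogeneous v t ht

theorem hess_symm (hv : v ≠ 0) (u w : V) :
    fderiv ℝ (fderiv ℝ f) v u w = fderiv ℝ (fderiv ℝ f) v w u :=
  ((hf.contDiffAt hv).isSymmSndFDerivAt
    (by rw [minSmoothness_of_isRCLikeNormedField]; exact WithTop.coe_le_coe.2 le_top)).eq u w

theorem hess_self (hv : v ≠ 0) : fderiv ℝ (fderiv ℝ f) v v = 0 := by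
  have hd := (hf.differentiableAt_fderiv hv).hasFDerivAt
  rw [← one_smul ℝ v] at hd
  have hray := hd.comp_hasDerivAt (1 : ℝ) ((hasDerivAt_id (1 : ℝ)).smul_const v)
  simp only [one_smul] at hray
  refine hray.unique ((hasDerivAt_const (1 : ℝ) (fderiv ℝ f v)).congr_of_eventuallyEq ?_)
  filter_upwards [lt_mem_nhds zero_lt_one] with t ht using hf.fderiv_smul v ht

theorem hess_apply_self (hv : v ≠ 0) (u : V) : fderiv ℝ (fderiv ℝ f) v u v = 0 := by
  rw [hf.hess_symm hv, hf.hess_self hv, zero_apply]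

theorem hasDerivAt_line {t : ℝ} (h : v + t • w ≠ 0) :
    HasDerivAt (fun t : ℝ => f (v + t • w)) (fderiv ℝ f (v + t • w) w) t :=
  (hf.differentiableAt h).hasFDerivAt.comp_hasDerivAt t (hasDerivAt_add_smul v w t)

theorem hasDerivAt_fderiv_line {t : ℝ} (h : v + t • w ≠ 0) :
    HasDerivAt (fun t : ℝ => fderiv ℝ f (v + t • w) w)
      (fderiv ℝ (fderiv ℝ f) (v + t • w) w w) t := by
  have hd := (hf.differentiableAt_fderiv h).hasFDerivAt.comp_hasDerivAt t
    (hasDerivAt_add_smul v w t)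
  simpa using hd.clm_apply (hasDerivAt_const t w)

theorem hess_sq_pos (hv : v ≠ 0) (hw : w ≠ 0) :
    0 < (fderiv ℝ f v w) ^ 2 + f v * fderiv ℝ (fderiv ℝ f) v w w := by
  have hne : v + (0 : ℝ) • w ≠ 0 := by simpa using hv
  have hderiv : deriv (fun t : ℝ => f (v + t • w) ^ 2) =ᶠ[𝓝 0]
      fun t : ℝ => 2 * (f (v + t • w) * fderiv ℝ f (v + t • w) w) := by
    filter_upwards [(hasDerivAt_add_smul v w 0).continuousAt.eventually_ne hne] with t ht
    exact (((hf.hasDerivAt_line ht).fun_pow 2).congr_deriv (by ring)).deriv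
  have hconvex := hf.stronglyConvex v w hv hw
  rw [iteratedDeriv_succ, iteratedDeriv_one, hderiv.deriv_eq,
    (((hf.hasDerivAt_line hne).fun_mul (hf.hasDerivAt_fderiv_line hne)).const_mul 2).deriv]
    at hconvex
  simp only [zero_smul, add_zero] at hconvex
  linarith

theorem hess_pos (h : LinearIndependent ℝ ![v, w]) : 0 < fderiv ℝ (fderiv ℝ f) v w w := by
  have hv : v ≠ 0 := h.ne_zero 0
  -- The component `u` of `w` in the kernel of `df_v` has the same Hessian as `w`.
  set u := w - (fderiv ℝ f v w / f v) • v with hu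
  have hu0 : u ≠ 0 := sub_ne_zero.2 ((LinearIndependent.pair_iff' hv).1 h _).symm
  have hdu : fderiv ℝ f v u = 0 := by
    rw [hu, map_sub, map_smul, hf.fderiv_self hv, smul_eq_mul,
      div_mul_cancel₀ _ (hf.pos v hv).ne', sub_self]
  have huw : fderiv ℝ (fderiv ℝ f) v u u = fderiv ℝ (fderiv ℝ f) v w w := by
    simp [hu, hf.hess_self hv, hf.hess_apply_self hv]
  have hpos := hf.hess_sq_pos hv hu0
  rw [hdu, huw, zero_pow two_ne_zero, zero_add] at hpos
  exact pos_of_mul_pos_right hpos (hf.nonneg v)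

theorem fderiv_lt (h : LinearIndependent ℝ ![v, w]) : fderiv ℝ f v w < f w := by
  have hv : v ≠ 0 := h.ne_zero 0
  have hline (t : ℝ) : LinearIndependent ℝ ![v + t • (w - v), w - v] := by
    rw [LinearIndependent.pair_add_smul_left_iff, sub_eq_add_neg, ← neg_one_smul ℝ v, add_comm,
      LinearIndependent.pair_add_smul_right_iff]
    exact h
  have hne (t : ℝ) : v + t • (w - v) ≠ 0 := (hline t).ne_zero 0
  have hmono : StrictMono fun t : ℝ => fderiv ℝ f (v + t • (w - v)) (w - v) :=
    strictMono_of_hasDerivAt_pos (fun t => hf.hasDerivAt_fderiv_line (hne t))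
      fun t => hf.hess_pos (hline t)
  obtain ⟨c, hc, hslope⟩ := exists_hasDerivAt_eq_slope _ _ zero_lt_one
    (continuous_iff_continuousAt.2 fun t => (hf.hasDerivAt_line (hne t)).continuousAt).continuousOn
    fun t _ => hf.hasDerivAt_line (hne t)
  have hlt := hmono hc.1
  simp only [hslope, zero_smul, add_zero, one_smul, add_sub_cancel, sub_zero, div_one, map_sub]
    at hlt
  rw [hf.fderiv_self hv] at hlt
  linarith

theorem fderiv_le (hv : v ≠ 0) (w : V) : fderiv ℝ f v w ≤ f w := by
  by_cases h : LinearIndependent ℝ ![v, w]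
  · exact (hf.fderiv_lt h).le
  obtain ⟨c, rfl⟩ : ∃ c : ℝ, c • v = w := by simpa [LinearIndependent.pair_iff' hv] using h
  rw [map_smul, hf.fderiv_self hv, smul_eq_mul]
  rcases lt_or_ge 0 c with hc | hc
  · rw [hf.homogeneous v c hc]
  · exact (mul_nonpos_of_nonpos_of_nonneg hc (hf.nonneg v)).trans (hf.nonneg _)

theorem exists_pos_smul_eq_of_fderiv_eq (hv : v ≠ 0) (hw : w ≠ 0)
    (h : fderiv ℝ f v = fderiv ℝ f w) : ∃ c : ℝ, 0 < c ∧ c • v = w := by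
  have hdw : fderiv ℝ f v w = f w := by rw [h, hf.fderiv_self hw]
  obtain ⟨c, rfl⟩ : ∃ c : ℝ, c • v = w := by
    have hdep : ¬ LinearIndependent ℝ ![v, w] := fun hli => (hf.fderiv_lt hli).ne hdw
    simpa [LinearIndependent.pair_iff' hv] using hdep
  rw [map_smul, hf.fderiv_self hv, smul_eq_mul] at hdw
  exact ⟨c, pos_of_mul_pos_left (hdw ▸ hf.pos _ hw) (hf.nonneg v), rfl⟩

end IsMinkowskiNorm

end Minkowski

/-! ### The polar map -/

section Polar

open MeasureTheory Gradient InnerProductSpace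

variable {V : Type*} [NormedAddCommGroup V] [InnerProductSpace ℝ V]

theorem hasFDerivAt_norm {v : V} (hv : v ≠ 0) :
    HasFDerivAt (fun v : V => ‖v‖) (‖v‖⁻¹ • innerSL ℝ v) v := by
  have hsqrt := (hasStrictFDerivAt_norm_sq v).hasFDerivAt.sqrt (by simpa using hv)
  simp only [Real.sqrt_sq (norm_nonneg _)] at hsqrt
  refine hsqrt.congr_fderiv ?_
  rw [← Nat.cast_smul_eq_nsmul ℝ, smul_smul]
  congr 1
  field_simp
  norm_num

variable [FiniteDimensional ℝ V]

/-- The homogeneous map `v ↦ ‖v‖ df_v` into the dual of `V`, which is identified with `V` through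
the inner product. For a Minkowski norm `f` it maps the Euclidean unit ball onto the unit ball of
the norm dual to `f`. -/
def polarMap (f : V → ℝ) (v : V) : V := ‖v‖ • ∇ f v

/-- The Jacobian of `polarMap f`, which is the density of the angle measure of `f` with respect to
the Euclidean one. -/
def polarJacobian (f : V → ℝ) (v : V) : ℝ := (fderiv ℝ (polarMap f) v).det

theorem inner_polarMap (f : V → ℝ) (v w : V) :
    inner ℝ (polarMap f v) w = ‖v‖ * fderiv ℝ f v w := by
  rw [polarMap, real_inner_smul_left, gradient, toDual_symm_apply]

namespace IsMinkowskiNorm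

variable {f : V → ℝ} (hf : IsMinkowskiNorm f) {v w : V}
include hf

theorem contDiffOn_polarMap : ContDiffOn ℝ ∞ (polarMap f) {0}ᶜ :=
  ContDiffOn.smul (fun _ hv => (contDiffAt_norm ℝ hv).contDiffWithinAt)
    ((toDual ℝ V).symm.contDiff.comp_contDiffOn
      (hf.smooth.fderiv_of_isOpen isOpen_compl_singleton (by simp)))

theorem continuousOn_polarJacobian : ContinuousOn (polarJacobian f) {0}ᶜ :=
  ContinuousLinearMap.continuous_det.comp_continuousOn
    (hf.contDiffOn_polarMap.continuousOn_fderiv_of_isOpen isOpen_compl_singleton (by simp))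

theorem polarMap_smul (v : V) {c : ℝ} (hc : 0 < c) : polarMap f (c • v) = c • polarMap f v := by
  rw [polarMap, polarMap, gradient, gradient, hf.fderiv_smul v hc, norm_smul,
    Real.norm_of_nonneg hc.le, smul_smul]

theorem polarJacobian_smul (v : V) {c : ℝ} (hc : 0 < c) :
    polarJacobian f (c • v) = polarJacobian f v := by
  have hcomp := fderiv_comp_smul (f := polarMap f) (x := v) c
  rw [show (fun x => polarMap f (c • x)) = c • polarMap f from
    funext fun x => hf.polarMap_smul x hc, fderiv_const_smul_field] at hcomp
  rw [polarJacobian, polarJacobian, ← smul_right_injective _ hc.ne' hcomp]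

theorem inner_fderiv_polarMap (hv : v ≠ 0) (u w : V) :
    inner ℝ (fderiv ℝ (polarMap f) v u) w =
      ‖v‖ * fderiv ℝ (fderiv ℝ f) v u w + ‖v‖⁻¹ * inner ℝ v u * fderiv ℝ f v w := by
  have hpolar : DifferentiableAt ℝ (polarMap f) v :=
    (hf.contDiffOn_polarMap.contDiffAt (isOpen_compl_singleton.mem_nhds hv)).differentiableAt
      (by simp)
  have hinner := hpolar.hasFDerivAt.inner ℝ (hasFDerivAt_const w v)
  simp only [inner_polarMap] at hinner
  have hmul := (hasFDerivAt_norm hv).mul ((hf.differentiableAt_fderiv hv).hasFDerivAt.clm_apply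
    (hasFDerivAt_const w v))
  simpa [mul_comm] using DFunLike.congr_fun (hinner.unique hmul) u

end IsMinkowskiNorm

section Basis

open Matrix

variable {ι : Type*} [Fintype ι] (b : OrthonormalBasis ι ℝ V) {f : V → ℝ}

/-- The matrix of the second derivative of `f` at `v` in the basis `b`. -/
def hessMatrix (f : V → ℝ) (v : V) : Matrix ι ι ℝ :=
  of fun i k => fderiv ℝ (fderiv ℝ f) v (b i) (b k)

omit [FiniteDimensional ℝ V] in
theorem sum_apply_mul_inner (ξ : V →L[ℝ] ℝ) (w : V) : ∑ i, ξ (b i) * inner ℝ (b i) w = ξ w := by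
  conv_rhs => rw [← b.sum_repr' w, map_sum]
  simp only [map_smul, smul_eq_mul, mul_comm]

omit [FiniteDimensional ℝ V] in
theorem hessMatrix_mulVec (f : V → ℝ) (v w : V) :
    hessMatrix b f v *ᵥ (fun k => inner ℝ (b k) w) =
      fun i => fderiv ℝ (fderiv ℝ f) v (b i) w :=
  funext fun i => sum_apply_mul_inner b (fderiv ℝ (fderiv ℝ f) v (b i)) w

namespace IsMinkowskiNorm

variable (hf : IsMinkowskiNorm f) {v : V}
include hf

omit [FiniteDimensional ℝ V] in
theorem hessMatrix_mulVec_self (hv : v ≠ 0) :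
    hessMatrix b f v *ᵥ (fun k => inner ℝ (b k) v) = 0 := by
  rw [hessMatrix_mulVec]
  exact funext fun i => hf.hess_apply_self hv (b i)

omit [FiniteDimensional ℝ V] in
theorem dotProduct_hessMatrix_mulVec (hv : v ≠ 0) (w : V) :
    (fun i => inner ℝ (b i) w) ⬝ᵥ (hessMatrix b f v *ᵥ fun k => inner ℝ (b k) w) =
      fderiv ℝ (fderiv ℝ f) v w w := by
  rw [hessMatrix_mulVec, dotProduct_comm]
  simp only [hf.hess_symm hv _ w]
  exact sum_apply_mul_inner b _ w

omit [FiniteDimensional ℝ V] in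
theorem posDef_hessMatrix_add (hv : v ≠ 0) : (hessMatrix b f v +
    vecMulVec (fun i => inner ℝ (b i) v) fun k => inner ℝ (b k) v).PosDef := by
  refine posDef_iff_dotProduct_mulVec.2 ⟨?_, fun w hw => ?_⟩
  · ext i k
    simp [hessMatrix, vecMulVec_apply, hf.hess_symm hv (b i), mul_comm]
  obtain ⟨w, rfl⟩ : ∃ u : V, (fun i => inner ℝ (b i) u) = w :=
    ⟨b.repr.symm (WithLp.toLp 2 w), funext fun i => by rw [← b.repr_apply_apply]; simp⟩
  have hw0 : w ≠ 0 := by rintro rfl; simp [Pi.zero_def] at hw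
  have hform : star (fun i => inner ℝ (b i) w) ⬝ᵥ ((hessMatrix b f v +
      vecMulVec (fun i => inner ℝ (b i) v) fun k => inner ℝ (b k) v) *ᵥ fun i => inner ℝ (b i) w) =
      fderiv ℝ (fderiv ℝ f) v w w + inner ℝ v w ^ 2 := by
    have hinner : (fun i => inner ℝ (b i) v) ⬝ᵥ (fun i => inner ℝ (b i) w) = inner ℝ v w := by
      simpa [dotProduct, real_inner_comm] using b.sum_inner_mul_inner v w
    rw [star_trivial, add_mulVec, dotProduct_add, hf.dotProduct_hessMatrix_mulVec b hv,
      vecMulVec_mulVec, dotProduct_smul, dotProduct_comm _ (fun i => inner ℝ (b i) v), hinner]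
    simp [sq]
  rw [hform]
  by_cases hli : LinearIndependent ℝ ![v, w]
  · exact add_pos_of_pos_of_nonneg (hf.hess_pos hli) (sq_nonneg _)
  obtain ⟨c, rfl⟩ : ∃ c : ℝ, c • v = w := by simpa [LinearIndependent.pair_iff' hv] using hli
  have hc : c ≠ 0 := left_ne_zero_of_smul hw0
  rw [map_smul _ c, hf.hess_apply_self hv, smul_zero, zero_add, real_inner_smul_right]
  have := real_inner_self_pos.2 hv
  positivity

variable [DecidableEq ι]

theorem polarJacobian_eq (hv : ‖v‖ = 1) : polarJacobian f v =
    (hessMatrix b f v + vecMulVec (fun i => inner ℝ (b i) v) fun k => fderiv ℝ f v (b k)).det := by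
  have hv0 : v ≠ 0 := norm_ne_zero_iff.1 (hv ▸ one_ne_zero)
  rw [polarJacobian, ContinuousLinearMap.det, ← LinearMap.det_toMatrix b.toBasis, ← det_transpose]
  congr 1
  ext i k
  rw [transpose_apply, LinearMap.toMatrix_apply, b.coe_toBasis_repr_apply, b.repr_apply_apply,
    real_inner_comm, b.coe_toBasis, ContinuousLinearMap.coe_coe, hf.inner_fderiv_polarMap hv0, hv]
  simp [hessMatrix, vecMulVec_apply, real_inner_comm]

omit [FiniteDimensional ℝ V] in
theorem det_hessMatrix (hv : v ≠ 0) : (hessMatrix b f v).det = 0 := by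
  refine exists_mulVec_eq_zero_iff.1 ⟨_, fun h => hv ?_, hf.hessMatrix_mulVec_self b hv⟩
  rw [← b.sum_repr' v]
  exact Finset.sum_eq_zero fun i _ => by rw [show inner ℝ (b i) v = 0 from congrFun h i, zero_smul]

end IsMinkowskiNorm

end Basis

namespace IsMinkowskiNorm

variable {f : V → ℝ} (hf : IsMinkowskiNorm f) {v w : V}
include hf

theorem polarJacobian_pos (hv : v ≠ 0) : 0 < polarJacobian f v := by
  wlog hunit : ‖v‖ = 1 generalizing v
  · have hnorm := norm_pos_iff.2 hv
    rw [← hf.polarJacobian_smul v (inv_pos.2 hnorm)]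
    exact this (smul_ne_zero (inv_ne_zero hnorm.ne') hv) (norm_smul_inv_norm hv)
  have hinner : (fun i => inner ℝ (stdOrthonormalBasis ℝ V i) v) ⬝ᵥ
      (fun i => inner ℝ (stdOrthonormalBasis ℝ V i) v) = 1 := by
    simpa [dotProduct, real_inner_comm, hunit] using
      (stdOrthonormalBasis ℝ V).sum_inner_mul_inner v v
  have hEuler : (fun i => fderiv ℝ f v (stdOrthonormalBasis ℝ V i)) ⬝ᵥ
      (fun i => inner ℝ (stdOrthonormalBasis ℝ V i) v) = f v := by
    rw [← hf.fderiv_self hv]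
    exact sum_apply_mul_inner _ _ v
  rw [hf.polarJacobian_eq (stdOrthonormalBasis ℝ V) hunit, det_add_vecMulVec_of_mulVec_eq_zero _ _
    (hf.hessMatrix_mulVec_self _ hv) hinner, hEuler]
  exact mul_pos (hf.pos v hv) (hf.posDef_hessMatrix_add _ hv).det_pos

theorem norm_le_of_polarMap_eq (hv : v ≠ 0) (hw : w ≠ 0) (h : polarMap f v = polarMap f w) :
    ‖v‖ ≤ ‖w‖ := by
  refine le_of_mul_le_mul_right ?_ (hf.pos v hv)
  calc ‖v‖ * f v = ‖w‖ * fderiv ℝ f w v := by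
        rw [← hf.fderiv_self hv, ← inner_polarMap, h, inner_polarMap]
    _ ≤ ‖w‖ * f v := mul_le_mul_of_nonneg_left (hf.fderiv_le hw v) (norm_nonneg w)

theorem injOn_polarMap : Set.InjOn (polarMap f) {0}ᶜ := by
  intro v hv w hw h
  have hnorm : ‖v‖ = ‖w‖ :=
    (hf.norm_le_of_polarMap_eq hv hw h).antisymm (hf.norm_le_of_polarMap_eq hw hv h.symm)
  rw [polarMap, polarMap, ← hnorm] at h
  have hderiv : fderiv ℝ f v = fderiv ℝ f w :=
    (toDual ℝ V).symm.injective (smul_right_injective _ (norm_ne_zero_iff.2 hv) h)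
  obtain ⟨c, hc, rfl⟩ := hf.exists_pos_smul_eq_of_fderiv_eq hv hw hderiv
  rw [norm_smul, Real.norm_of_nonneg hc.le, eq_comm, mul_eq_right₀ (norm_ne_zero_iff.2 hv)] at hnorm
  rw [hnorm, one_smul]

theorem exists_isMaxOn_div {ξ : V} (hξ : ξ ≠ 0) :
    ∃ v, v ≠ 0 ∧ 0 < inner ℝ ξ v ∧ ∀ w, w ≠ 0 → inner ℝ ξ w / f w ≤ inner ℝ ξ v / f v := by
  have hne {u : V} (hu : u ∈ Metric.sphere (0 : V) 1) : u ≠ 0 :=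
    Metric.ne_of_mem_sphere hu one_ne_zero
  have hcont : ContinuousOn (fun u => inner ℝ ξ u / f u) (Metric.sphere 0 1) :=
    ContinuousOn.div (by fun_prop) (hf.smooth.continuousOn.mono fun u hu => hne hu)
      fun u hu => (hf.pos u (hne hu)).ne'
  obtain ⟨v, hv, hmax⟩ := (isCompact_sphere (0 : V) 1).exists_isMaxOn
    ⟨‖ξ‖⁻¹ • ξ, by simpa using norm_smul_inv_norm (𝕜 := ℝ) hξ⟩ hcont
  have hmax_all (w : V) (hw : w ≠ 0) : inner ℝ ξ w / f w ≤ inner ℝ ξ v / f v := by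
    have hscale : inner ℝ ξ (‖w‖⁻¹ • w) / f (‖w‖⁻¹ • w) = inner ℝ ξ w / f w := by
      have hnorm : 0 < ‖w‖⁻¹ := inv_pos.2 (norm_pos_iff.2 hw)
      rw [real_inner_smul_right, hf.homogeneous w _ hnorm, mul_div_mul_left _ _ hnorm.ne']
    rw [← hscale]
    exact hmax (by simpa using norm_smul_inv_norm (𝕜 := ℝ) hw)
  have hpos : 0 < inner ℝ ξ v / f v :=
    (div_pos (real_inner_self_pos.2 hξ) (hf.pos ξ hξ)).trans_le (hmax_all ξ hξ)
  exact ⟨v, hne hv, (div_pos_iff_of_pos_right (hf.pos v (hne hv))).1 hpos, hmax_all⟩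

omit [FiniteDimensional ℝ V] in
theorem inner_eq_mul_fderiv_of_isMaxOn_div {ξ : V} (hv : v ≠ 0)
    (hmax : ∀ w, w ≠ 0 → inner ℝ ξ w / f w ≤ inner ℝ ξ v / f v) (w : V) :
    inner ℝ ξ w = inner ℝ ξ v / f v * fderiv ℝ f v w := by
  have hlocal : IsLocalMax (fun u => innerSL ℝ ξ u - inner ℝ ξ v / f v * f u) v := by
    filter_upwards [isOpen_compl_singleton.mem_nhds hv] with u hu
    rw [innerSL_apply_apply, innerSL_apply_apply, div_mul_cancel₀ _ (hf.pos v hv).ne', sub_self,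
      sub_nonpos]
    exact (div_le_iff₀ (hf.pos u hu)).1 (hmax u hu)
  have hcrit := hlocal.hasFDerivAt_eq_zero ((innerSL ℝ ξ).hasFDerivAt.sub
    ((hf.differentiableAt hv).hasFDerivAt.const_mul (inner ℝ ξ v / f v)))
  simpa [sub_eq_zero] using DFunLike.congr_fun hcrit w

theorem exists_polarMap_eq {ξ : V} (hξ : ξ ≠ 0) : ∃ v, v ≠ 0 ∧ polarMap f v = ξ := by
  obtain ⟨v, hv, hpos, hmax⟩ := hf.exists_isMaxOn_div hξ
  have hscale : 0 < inner ℝ ξ v / f v * ‖v‖⁻¹ :=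
    mul_pos (div_pos hpos (hf.pos v hv)) (inv_pos.2 (norm_pos_iff.2 hv))
  refine ⟨_, smul_ne_zero hscale.ne' hv, ext_inner_right ℝ fun w => ?_⟩
  rw [hf.polarMap_smul v hscale, real_inner_smul_left, inner_polarMap,
    hf.inner_eq_mul_fderiv_of_isMaxOn_div hv hmax w, mul_assoc,
    inv_mul_cancel_left₀ (norm_ne_zero_iff.2 hv)]

theorem lintegral_polarJacobian [MeasurableSpace V] [BorelSpace V] (μ : Measure V)
    [μ.IsAddHaarMeasure] {A : Set V} (hA : MeasurableSet A) (hA0 : A ⊆ {0}ᶜ) :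
    ∫⁻ v in A, ENNReal.ofReal (polarJacobian f v) ∂μ = μ (polarMap f '' A) := by
  have hdiff (v : V) (hv : v ∈ A) :
      HasFDerivWithinAt (polarMap f) (fderiv ℝ (polarMap f) v) A v :=
    ((hf.contDiffOn_polarMap.contDiffAt (isOpen_compl_singleton.mem_nhds (hA0 hv))).differentiableAt
      (by simp)).hasFDerivAt.hasFDerivWithinAt
  rw [← lintegral_abs_det_fderiv_eq_addHaar_image μ hA hdiff (hf.injOn_polarMap.mono hA0)]
  exact setLIntegral_congr_fun hA fun v hv => by
    rw [← polarJacobian, abs_of_pos (hf.polarJacobian_pos (hA0 hv))]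

end IsMinkowskiNorm

end Polar

/-! ### Integration over the sphere -/

section Sphere

open MeasureTheory Module

variable {V : Type*} [NormedAddCommGroup V] [NormedSpace ℝ V] {k : V → ℝ}

theorem indicator_ball_eq_mul_indicator (hk : ∀ v, ∀ c : ℝ, 0 < c → k (c • v) = k v)
    (v : ({0}ᶜ : Set V)) : (Metric.ball 0 1).indicator k v =
      k (homeomorphUnitSphereProd V v).1 *
        (Set.Iio ⟨1, Set.mem_Ioi.2 one_pos⟩).indicator 1 (homeomorphUnitSphereProd V v).2 := by
  have hnorm : 0 < ‖(v : V)‖⁻¹ := inv_pos.2 (norm_pos_iff.2 v.2)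
  by_cases hv : ‖(v : V)‖ < 1
  · simp [Set.indicator, hv, hk _ _ hnorm, ← Subtype.coe_lt_coe]
  · simp [Set.indicator, hv, ← Subtype.coe_lt_coe]

variable [FiniteDimensional ℝ V] [Nontrivial V] [MeasurableSpace V] [BorelSpace V]
  (μ : Measure V) [μ.IsAddHaarMeasure]

theorem integral_toSphere_eq_finrank_mul_setIntegral_ball
    (hk : ∀ v, ∀ c : ℝ, 0 < c → k (c • v) = k v) :
    ∫ s, k s ∂μ.toSphere = finrank ℝ V * ∫ v in Metric.ball 0 1, k v ∂μ := by
  have hrank : (finrank ℝ V : ℝ) ≠ 0 := Nat.cast_ne_zero.2 finrank_pos.ne'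
  have hradial : (Measure.volumeIoiPow (finrank ℝ V - 1)).real
      (Set.Iio ⟨1, Set.mem_Ioi.2 one_pos⟩) = (finrank ℝ V : ℝ)⁻¹ := by
    rw [measureReal_def, Measure.volumeIoiPow_apply_Iio, ENNReal.toReal_ofReal (by positivity),
      one_pow, Nat.cast_sub finrank_pos]
    simp
  have hball : ∫ v in Metric.ball 0 1, k v ∂μ = (∫ s, k s ∂μ.toSphere) * (finrank ℝ V : ℝ)⁻¹ :=
    calc ∫ v in Metric.ball 0 1, k v ∂μ
        = ∫ v : ({0}ᶜ : Set V), (Metric.ball 0 1).indicator k v ∂μ.comap (↑) := by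
          rw [integral_subtype_comap (measurableSet_singleton _).compl, restrict_compl_singleton,
            integral_indicator measurableSet_ball]
      _ = ∫ z : Metric.sphere (0 : V) 1 × Set.Ioi (0 : ℝ),
            k z.1 * (Set.Iio ⟨1, Set.mem_Ioi.2 one_pos⟩).indicator 1 z.2
            ∂μ.toSphere.prod (Measure.volumeIoiPow (finrank ℝ V - 1)) := by
          simp only [indicator_ball_eq_mul_indicator hk]
          exact μ.measurePreserving_homeomorphUnitSphereProd.integral_comp
            (Homeomorph.measurableEmbedding _) fun z : Metric.sphere (0 : V) 1 × Set.Ioi (0 : ℝ) =>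
              k z.1 * (Set.Iio ⟨1, Set.mem_Ioi.2 one_pos⟩).indicator 1 z.2
      _ = (∫ s, k s ∂μ.toSphere) * (finrank ℝ V : ℝ)⁻¹ := by
          rw [integral_prod_mul (fun s : Metric.sphere (0 : V) 1 => k s),
            integral_indicator_one measurableSet_Iio, hradial]
  rw [hball]
  field_simp

theorem integrableOn_ball_of_integrable_toSphere
    (hk : ∀ v, ∀ c : ℝ, 0 < c → k (c • v) = k v)
    (hint : Integrable (fun s : Metric.sphere (0 : V) 1 => k s) μ.toSphere) :
    IntegrableOn k (Metric.ball 0 1) μ := by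
  have hradial : Integrable ((Set.Iio ⟨1, Set.mem_Ioi.2 one_pos⟩).indicator
      (1 : Set.Ioi (0 : ℝ) → ℝ)) (Measure.volumeIoiPow (finrank ℝ V - 1)) := by
    rw [integrable_indicator_iff measurableSet_Iio]
    exact integrableOn_const (by simp [Measure.volumeIoiPow_apply_Iio])
  rw [← integrable_indicator_iff measurableSet_ball, ← restrict_compl_singleton (μ := μ) 0,
    ← IntegrableOn, integrableOn_iff_comap_subtypeVal (measurableSet_singleton _).compl,
    Function.comp_def]
  simp only [indicator_ball_eq_mul_indicator hk]
  exact (μ.measurePreserving_homeomorphUnitSphereProd.integrable_comp_emb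
    (Homeomorph.measurableEmbedding _)).2 (hint.mul_prod hradial)

end Sphere

/-! ### The dual gauge -/

section DualGauge

open MeasureTheory Module InnerProductSpace

/-- The function `f` lies between `C⁻¹ N` and `C N`, where `N` is absolutely homogeneous. -/
structure IsComparableGauge {V : Type*} [AddCommGroup V] [Module ℝ V] (C : ℝ) (f N : V → ℝ) :
    Prop where
  map_smul : ∀ (c : ℝ) (v : V), N (c • v) = |c| * N v
  gauge_le : ∀ v, N v ≤ C * f v
  le_gauge : ∀ v, f v ≤ C * N v

/-- The norm on linear forms that is dual to the gauge `N`. -/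
def dualGauge {V : Type*} [AddCommGroup V] [Module ℝ V] [TopologicalSpace V] (N : V → ℝ)
    (p : V →L[ℝ] ℝ) : ℝ :=
  sSup {t | ∃ v, N v = 1 ∧ t = p v}

open scoped Pointwise in
theorem dualGauge_smul {V : Type*} [AddCommGroup V] [Module ℝ V] [TopologicalSpace V] (N : V → ℝ)
    {c : ℝ} (hc : 0 ≤ c) (p : V →L[ℝ] ℝ) : dualGauge N (c • p) = c * dualGauge N p := by
  rw [dualGauge, dualGauge, ← smul_eq_mul, ← Real.sSup_smul_of_nonneg hc]
  congr 1
  ext t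
  simp only [Set.mem_smul_set]
  constructor
  · rintro ⟨v, hv, rfl⟩
    exact ⟨p v, ⟨v, hv, rfl⟩, rfl⟩
  · rintro ⟨_, ⟨v, hv, rfl⟩, rfl⟩
    exact ⟨v, hv, rfl⟩

variable {V : Type*} [NormedAddCommGroup V] [InnerProductSpace ℝ V]

/-- The ball of radius `r` for the norm dual to the gauge `N`, in the identification of linear forms
with vectors given by the inner product. -/
def dualBall (N : V → ℝ) (r : ℝ) : Set V := {ξ | ∀ v, inner ℝ ξ v ≤ r * N v}

theorem isClosed_dualBall (N : V → ℝ) (r : ℝ) : IsClosed (dualBall N r) := by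
  simp only [dualBall, Set.ofPred_forall]
  exact isClosed_iInter fun v => isClosed_le (by fun_prop) continuous_const

open scoped Pointwise in
theorem dualBall_mul (N : V → ℝ) {c : ℝ} (hc : 0 < c) (r : ℝ) :
    dualBall N (c * r) = c • dualBall N r := by
  ext ξ
  rw [Set.mem_smul_set_iff_inv_smul_mem₀ hc.ne']
  simp only [dualBall, Set.mem_ofPred_eq, real_inner_smul_left]
  exact forall_congr' fun v => by rw [inv_mul_le_iff₀ hc, mul_assoc]

namespace IsComparableGauge

variable {C : ℝ} {f N : V → ℝ}

theorem map_zero (h : IsComparableGauge C f N) : N 0 = 0 := by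
  simpa using h.map_smul 0 0

theorem map_neg (h : IsComparableGauge C f N) (v : V) : N (-v) = N v := by
  simpa using h.map_smul (-1) v

variable (h : IsComparableGauge C f N) (hf : IsMinkowskiNorm f) (hC : 0 < C)
  {p : V →L[ℝ] ℝ}
include h hf hC

theorem pos {v : V} (hv : v ≠ 0) : 0 < N v :=
  pos_of_mul_pos_right ((hf.pos v hv).trans_le (h.le_gauge v)) hC.le

theorem nonneg (v : V) : 0 ≤ N v :=
  nonneg_of_mul_nonneg_right ((hf.nonneg v).trans (h.le_gauge v)) hC

theorem exists_eq_one_of_apply_ne_zero (hp : p ≠ 0) : ∃ v, N v = 1 := by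
  obtain ⟨v, hv⟩ := DFunLike.ne_iff.1 hp
  have hNv := h.pos hf hC (v := v) (by rintro rfl; simp at hv)
  exact ⟨(N v)⁻¹ • v, by rw [h.map_smul, abs_of_pos (inv_pos.2 hNv), inv_mul_cancel₀ hNv.ne']⟩

theorem dualGauge_le (hp : p ≠ 0) {r : ℝ} (hr : ∀ v, p v ≤ r * N v) : dualGauge N p ≤ r := by
  obtain ⟨v, hv⟩ := h.exists_eq_one_of_apply_ne_zero hf hC hp
  refine csSup_le ⟨p v, v, hv, rfl⟩ ?_
  rintro _ ⟨u, hu, rfl⟩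
  simpa [hu] using hr u

variable [FiniteDimensional ℝ V] (hp : p ≠ 0)
include hp

omit hC in
theorem bddAbove_dualGauge : BddAbove {t | ∃ v, N v = 1 ∧ t = p v} := by
  have hξ : (toDual ℝ V).symm p ≠ 0 := by simpa using hp
  obtain ⟨v, hv, hpos, hmax⟩ := hf.exists_isMaxOn_div hξ
  simp only [toDual_symm_apply] at hpos hmax
  refine ⟨p v / f v * C, ?_⟩
  rintro _ ⟨u, hu, rfl⟩
  have hu0 : u ≠ 0 := by
    rintro rfl
    simp [h.map_zero] at hu
  calc p u ≤ p v / f v * f u := (div_le_iff₀ (hf.pos u hu0)).1 (hmax u hu0)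
    _ ≤ p v / f v * C := mul_le_mul_of_nonneg_left (by simpa [hu] using h.le_gauge u)
        (div_pos hpos (hf.pos v hv)).le

theorem apply_le_dualGauge_mul (v : V) : p v ≤ dualGauge N p * N v := by
  rcases eq_or_ne v 0 with rfl | hv
  · simp [h.map_zero]
  have hNv := h.pos hf hC hv
  rw [← div_le_iff₀ hNv]
  refine le_csSup (h.bddAbove_dualGauge hf hp) ⟨(N v)⁻¹ • v, ?_, ?_⟩
  · rw [h.map_smul, abs_of_pos (inv_pos.2 hNv), inv_mul_cancel₀ hNv.ne']
  · rw [_root_.map_smul, smul_eq_mul, div_eq_inv_mul]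

theorem abs_apply_le_dualGauge_mul (v : V) : |p v| ≤ dualGauge N p * N v :=
  abs_le'.2 ⟨h.apply_le_dualGauge_mul hf hC hp v, by
    rw [← _root_.map_neg, ← h.map_neg]
    exact h.apply_le_dualGauge_mul hf hC hp (-v)⟩

theorem dualGauge_pos : 0 < dualGauge N p := by
  obtain ⟨v, hv⟩ := DFunLike.ne_iff.1 hp
  exact pos_of_mul_pos_left ((abs_pos.2 hv).trans_le (h.abs_apply_le_dualGauge_mul hf hC hp v))
    (h.nonneg hf hC v)

end IsComparableGauge

/-! ### Vectors whose polar is close to a given form -/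

namespace IsComparableGauge

variable [FiniteDimensional ℝ V] {C : ℝ} {f N : V → ℝ} (h : IsComparableGauge C f N)
  (hf : IsMinkowskiNorm f) (hC : 0 < C) {p : V →L[ℝ] ℝ} {ε : ℝ} {v : V}

include h in
theorem abs_norm_mul_fderiv_sub_le
    (hmem : polarMap f v - (toDual ℝ V).symm p ∈ dualBall N ε) (w : V) :
    |‖v‖ * fderiv ℝ f v w - p w| ≤ ε * N w := by
  have hle (u : V) : ‖v‖ * fderiv ℝ f v u - p u ≤ ε * N u := by
    simpa only [inner_sub_left, inner_polarMap, toDual_symm_apply] using hmem u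
  refine abs_le'.2 ⟨hle w, ?_⟩
  have hneg := hle (-w)
  rw [h.map_neg, _root_.map_neg, _root_.map_neg] at hneg
  linarith

variable (hv : v ≠ 0) (hmem : polarMap f v - (toDual ℝ V).symm p ∈ dualBall N ε)
include h hf hv hmem

theorem norm_sub_le_div (hε : 0 ≤ ε) : ‖v‖ - ε * C ≤ p v / f v := by
  have habs := (abs_le.1 (h.abs_norm_mul_fderiv_sub_le hmem v)).2
  have hN : ε * N v ≤ ε * (C * f v) := mul_le_mul_of_nonneg_left (h.gauge_le v) hε
  rw [hf.fderiv_self hv] at habs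
  rw [le_div_iff₀ (hf.pos v hv)]
  linarith

include hC

theorem dualGauge_sub_le (hp : p ≠ 0) : dualGauge N p - ε ≤ C * ‖v‖ := by
  rw [sub_le_iff_le_add]
  refine h.dualGauge_le hf hC hp fun u => ?_
  have habs := (abs_le.1 (h.abs_norm_mul_fderiv_sub_le hmem u)).1
  have hderiv : ‖v‖ * fderiv ℝ f v u ≤ ‖v‖ * (C * N u) :=
    mul_le_mul_of_nonneg_left ((hf.fderiv_le hv u).trans (h.le_gauge u)) (norm_nonneg v)
  linarith

theorem norm_le_mul (hp : p ≠ 0) (hε : 0 ≤ ε) : ‖v‖ ≤ (dualGauge N p + ε) * C := by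
  have habs := (abs_le.1 (h.abs_norm_mul_fderiv_sub_le hmem v)).2
  rw [hf.fderiv_self hv] at habs
  refine le_of_mul_le_mul_right ?_ (hf.pos v hv)
  calc ‖v‖ * f v ≤ (dualGauge N p + ε) * N v := by
        linarith [h.apply_le_dualGauge_mul hf hC hp v]
    _ ≤ (dualGauge N p + ε) * (C * f v) := mul_le_mul_of_nonneg_left (h.gauge_le v)
        (add_nonneg (h.dualGauge_pos hf hC hp).le hε)
    _ = (dualGauge N p + ε) * C * f v := by ring

end IsComparableGauge

end DualGauge

/-! ### The symbol of a Minkowski norm -/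

section MinkowskiSymbol

open MeasureTheory Module InnerProductSpace

variable {V : Type*} [NormedAddCommGroup V] [InnerProductSpace ℝ V] [FiniteDimensional ℝ V]
  [MeasurableSpace V] (μ : Measure V)

/-- The total mass of the angle measure of `f` before normalization. -/
def angleVolume (f : V → ℝ) : ℝ := ∫ s, polarJacobian f s ∂μ.toSphere

/-- The quadratic form `p ↦ n · (mean of (p v / f v)²)` on linear forms, where the mean is taken
over the rays of `V` with respect to the angle measure of `f`. -/
def minkowskiSymbol (f : V → ℝ) (p : V →L[ℝ] ℝ) : ℝ :=
  finrank ℝ V / angleVolume μ f * ∫ s, (p s / f s) ^ 2 * polarJacobian f s ∂μ.toSphere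

theorem minkowskiSymbol_smul (f : V → ℝ) (c : ℝ) (p : V →L[ℝ] ℝ) :
    minkowskiSymbol μ f (c • p) = c ^ 2 * minkowskiSymbol μ f p := by
  simp only [minkowskiSymbol, smul_apply, smul_eq_mul, mul_div_assoc, mul_pow,
    mul_assoc, integral_const_mul]
  ring

/-- The vectors of the punctured unit ball whose polar is within `ε` of `p` in the norm dual to
`N`. -/
def nearPolar (f N : V → ℝ) (p : V →L[ℝ] ℝ) (ε : ℝ) : Set V :=
  (Metric.ball 0 1 \ {0}) ∩ polarMap f ⁻¹' ((fun ξ => ξ - (toDual ℝ V).symm p) ⁻¹' dualBall N ε)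

variable [BorelSpace V] [μ.IsAddHaarMeasure]

open scoped Pointwise in
theorem measure_dualBall_mul (N : V → ℝ) {c : ℝ} (hc : 0 < c) (r : ℝ) :
    μ (dualBall N (c * r)) = ENNReal.ofReal (c ^ finrank ℝ V) * μ (dualBall N r) := by
  rw [dualBall_mul N hc, Measure.addHaar_smul, abs_of_pos (by positivity)]

namespace IsMinkowskiNorm

variable {f : V → ℝ} (hf : IsMinkowskiNorm f) (p : V →L[ℝ] ℝ)
include hf

theorem integrable_mul_polarJacobian {k : V → ℝ} (hk : ContinuousOn k {0}ᶜ) :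
    Integrable (fun s : Metric.sphere (0 : V) 1 => k s * polarJacobian f s) μ.toSphere :=
  (continuousOn_iff_continuous_domRestrict.1 ((hk.mul hf.continuousOn_polarJacobian).mono
    fun _ hs => Metric.ne_of_mem_sphere hs one_ne_zero)).integrable_of_hasCompactSupport
    (HasCompactSupport.of_compactSpace _)

theorem measurableSet_nearPolar (N : V → ℝ) (ε : ℝ) : MeasurableSet (nearPolar f N p ε) := by
  have hcont : ContinuousOn (polarMap f) (Metric.ball 0 1 \ {0}) :=
    hf.contDiffOn_polarMap.continuousOn.mono fun v hv => hv.2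
  obtain ⟨U, hU, hnear⟩ := continuousOn_iff_isClosed.1 hcont _
    ((isClosed_dualBall N ε).preimage (f := fun ξ => ξ - (toDual ℝ V).symm p) (by fun_prop))
  rw [nearPolar, Set.inter_comm, hnear]
  exact hU.measurableSet.inter (measurableSet_ball.diff (measurableSet_singleton _))

theorem integrable_polarJacobian :
    Integrable (fun s : Metric.sphere (0 : V) 1 => polarJacobian f s) μ.toSphere := by
  simpa using hf.integrable_mul_polarJacobian μ (k := 1) continuousOn_const

omit [MeasurableSpace V] [BorelSpace V] [FiniteDimensional ℝ V] in
theorem continuousOn_div_sq : ContinuousOn (fun v => (p v / f v) ^ 2) {0}ᶜ :=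
  (p.continuous.continuousOn.div hf.smooth.continuousOn fun v hv => (hf.pos v hv).ne').pow 2

omit [MeasurableSpace V] [BorelSpace V] [FiniteDimensional ℝ V] in
theorem div_sq_smul (v : V) {c : ℝ} (hc : 0 < c) :
    (p (c • v) / f (c • v)) ^ 2 = (p v / f v) ^ 2 := by
  rw [hf.homogeneous v c hc, map_smul, smul_eq_mul, mul_div_mul_left _ _ hc.ne']

variable [Nontrivial V]

theorem angleVolume_pos : 0 < angleVolume μ f := by
  have hpos (s : Metric.sphere (0 : V) 1) : 0 < polarJacobian f s :=
    hf.polarJacobian_pos (Metric.ne_of_mem_sphere s.2 one_ne_zero)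
  rw [angleVolume, integral_pos_iff_support_of_nonneg (fun s => (hpos s).le)
    (hf.integrable_polarJacobian μ), Function.support_eq_univ fun s => (hpos s).ne']
  exact Measure.measure_univ_pos.2 (Measure.toSphere_ne_zero _)

theorem integrableOn_polarJacobian : IntegrableOn (polarJacobian f) (Metric.ball 0 1) μ :=
  integrableOn_ball_of_integrable_toSphere μ (fun v _ hc => hf.polarJacobian_smul v hc)
    (hf.integrable_polarJacobian μ)

theorem ofReal_setIntegral_polarJacobian {A : Set V} (hA : MeasurableSet A)
    (hAB : A ⊆ Metric.ball 0 1 \ {0}) :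
    ENNReal.ofReal (∫ v in A, polarJacobian f v ∂μ) = μ (polarMap f '' A) := by
  rw [← hf.lintegral_polarJacobian μ hA fun v hv => (hAB hv).2, ofReal_integral_eq_lintegral_ofReal
    ((hf.integrableOn_polarJacobian μ).mono_set fun v hv => (hAB hv).1)]
  filter_upwards [ae_restrict_mem hA] with v hv
  exact (hf.polarJacobian_pos (hAB hv).2).le

end IsMinkowskiNorm

namespace IsComparableGauge

variable {C : ℝ} {f N : V → ℝ} (h : IsComparableGauge C f N) (hf : IsMinkowskiNorm f)
include h hf

omit [MeasurableSpace V] [BorelSpace V] in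
theorem image_polarMap_subset (hC : 0 < C) :
    polarMap f '' (Metric.ball 0 1 \ {0}) ⊆ dualBall N C := by
  rintro _ ⟨v, ⟨hv1, hv⟩, rfl⟩ w
  rw [inner_polarMap]
  calc ‖v‖ * fderiv ℝ f v w ≤ ‖v‖ * (C * N w) :=
        mul_le_mul_of_nonneg_left ((hf.fderiv_le hv w).trans (h.le_gauge w)) (norm_nonneg v)
    _ ≤ C * N w := mul_le_of_le_one_left (mul_nonneg hC.le (h.nonneg hf hC w))
        (mem_ball_zero_iff.1 hv1).le

omit [MeasurableSpace V] [BorelSpace V] in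
theorem subset_image_nearPolar (hC : 0 < C) {p : V →L[ℝ] ℝ} (hp : p ≠ 0) {ε : ℝ} (hε : 0 ≤ ε)
    (hεp : ε < dualGauge N p) (hball : (dualGauge N p + ε) * C < 1) :
    (fun ξ => ξ - (toDual ℝ V).symm p) ⁻¹' dualBall N ε ⊆ polarMap f '' nearPolar f N p ε := by
  intro ξ hξ
  have hξ0 : ξ ≠ 0 := by
    rintro rfl
    refine hεp.not_ge (h.dualGauge_le hf hC hp fun v => ?_)
    simpa [h.map_neg] using hξ (-v)
  obtain ⟨v, hv, rfl⟩ := hf.exists_polarMap_eq hξ0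
  exact ⟨v, ⟨⟨mem_ball_zero_iff.2 ((h.norm_le_mul hf hC hv hξ hp hε).trans_lt hball), hv⟩, hξ⟩, rfl⟩

variable [Nontrivial V]

theorem pow_mul_setIntegral_ball_le (hC : 0 < C) {p : V →L[ℝ] ℝ} (hp : p ≠ 0) {c : ℝ} (hc : 0 < c)
    (hεp : c * C < dualGauge N p) (hball : (dualGauge N p + c * C) * C < 1) :
    c ^ finrank ℝ V * ∫ v in Metric.ball 0 1, polarJacobian f v ∂μ ≤
      ∫ v in nearPolar f N p (c * C), polarJacobian f v ∂μ := by
  have hnear := hf.measurableSet_nearPolar p N (c * C)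
  have hnonneg : 0 ≤ ∫ v in nearPolar f N p (c * C), polarJacobian f v ∂μ :=
    setIntegral_nonneg hnear fun v hv => (hf.polarJacobian_pos hv.1.2).le
  have hpunctured : ∫ v in Metric.ball 0 1, polarJacobian f v ∂μ =
      ∫ v in Metric.ball 0 1 \ {0}, polarJacobian f v ∂μ :=
    (setIntegral_congr_set (sdiff_null_ae_eq_self (measure_singleton 0))).symm
  rw [← ENNReal.ofReal_le_ofReal_iff hnonneg, ENNReal.ofReal_mul (by positivity), hpunctured,
    hf.ofReal_setIntegral_polarJacobian μ (measurableSet_ball.diff (measurableSet_singleton _))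
      subset_rfl, hf.ofReal_setIntegral_polarJacobian μ hnear Set.inter_subset_left]
  calc ENNReal.ofReal (c ^ finrank ℝ V) * μ (polarMap f '' (Metric.ball 0 1 \ {0}))
      ≤ ENNReal.ofReal (c ^ finrank ℝ V) * μ (dualBall N C) := by
        gcongr
        exact h.image_polarMap_subset hf hC
    _ = μ ((fun ξ => ξ - (toDual ℝ V).symm p) ⁻¹' dualBall N (c * C)) := by
        simp only [sub_eq_add_neg, measure_preimage_add_right, measure_dualBall_mul μ N hc]
    _ ≤ μ (polarMap f '' nearPolar f N p (c * C)) :=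
        measure_mono (h.subset_image_nearPolar hf hC hp (by positivity) hεp hball)

theorem pow_mul_angleVolume_le (hC : 0 < C) {p : V →L[ℝ] ℝ} (hp : p ≠ 0) {c : ℝ} (hc : 0 < c)
    (hεp : c * C < dualGauge N p) (hball : (dualGauge N p + c * C) * C < 1) {a : ℝ} (ha : 0 ≤ a)
    (hle : ∀ v ∈ nearPolar f N p (c * C), a ≤ p v / f v) :
    a ^ 2 * c ^ finrank ℝ V * angleVolume μ f ≤
      ∫ s, (p s / f s) ^ 2 * polarJacobian f s ∂μ.toSphere := by
  let k (v : V) : ℝ := (p v / f v) ^ 2 * polarJacobian f v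
  have hk (v : V) (c : ℝ) (hc : 0 < c) : k (c • v) = k v := by
    simp only [k, hf.div_sq_smul p v hc, hf.polarJacobian_smul v hc]
  have hint : IntegrableOn k (Metric.ball 0 1) μ := integrableOn_ball_of_integrable_toSphere μ hk
    (hf.integrable_mul_polarJacobian μ (hf.continuousOn_div_sq p))
  have hnear := hf.measurableSet_nearPolar p N (c * C)
  have hsub : nearPolar f N p (c * C) ⊆ Metric.ball 0 1 := fun v hv => hv.1.1
  rw [angleVolume, integral_toSphere_eq_finrank_mul_setIntegral_ball μ (k := k) hk,
    integral_toSphere_eq_finrank_mul_setIntegral_ball μ fun v _ hc => hf.polarJacobian_smul v hc,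
    mul_left_comm]
  refine mul_le_mul_of_nonneg_left ?_ (Nat.cast_nonneg _)
  calc a ^ 2 * c ^ finrank ℝ V * ∫ v in Metric.ball 0 1, polarJacobian f v ∂μ
      ≤ a ^ 2 * ∫ v in nearPolar f N p (c * C), polarJacobian f v ∂μ := by
        rw [mul_assoc]
        exact mul_le_mul_of_nonneg_left (h.pow_mul_setIntegral_ball_le μ hf hC hp hc hεp hball)
          (sq_nonneg a)
    _ = ∫ v in nearPolar f N p (c * C), a ^ 2 * polarJacobian f v ∂μ :=
        (integral_const_mul _ _).symm
    _ ≤ ∫ v in nearPolar f N p (c * C), k v ∂μ :=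
        setIntegral_mono_on (((hf.integrableOn_polarJacobian μ).mono_set hsub).const_mul _)
          (hint.mono_set hsub) hnear fun v hv => mul_le_mul_of_nonneg_right
            (pow_le_pow_left₀ ha (hle v hv) 2) (hf.polarJacobian_pos hv.1.2).le
    _ ≤ ∫ v in Metric.ball 0 1, k v ∂μ := by
        refine setIntegral_mono_set hint ?_ hsub.eventuallyLE
        filter_upwards [ae_restrict_of_ae (compl_mem_ae_iff.2 (measure_singleton (μ := μ) 0))]
          with v hv
        exact mul_nonneg (sq_nonneg _) (hf.polarJacobian_pos hv).le

omit [MeasurableSpace V] [BorelSpace V] [Nontrivial V] in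
theorem le_div_of_mem_nearPolar (hC : 1 ≤ C) {p : V →L[ℝ] ℝ} (hp : p ≠ 0)
    (hnormalized : dualGauge N p = C⁻¹ / 4) {v : V} (hv : v ∈ nearPolar f N p (C⁻¹ ^ 3 / 16)) :
    C⁻¹ ^ 2 / 8 ≤ p v / f v := by
  have hC0 : 0 < C := one_pos.trans_le hC
  have hinv : 0 < C⁻¹ := inv_pos.2 hC0
  have hinv_sq : C⁻¹ ^ 2 ≤ 1 := pow_le_one₀ hinv.le (inv_le_one_of_one_le₀ hC)
  have hnorm : C⁻¹ * (C⁻¹ / 4 - C⁻¹ ^ 3 / 16) ≤ ‖v‖ :=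
    (inv_mul_le_iff₀ hC0).2 (hnormalized ▸ h.dualGauge_sub_le hf hC0 hv.1.2 hv.2 hp)
  have hratio := h.norm_sub_le_div hf hv.1.2 hv.2 (by positivity)
  have hε : C⁻¹ ^ 3 / 16 * C = C⁻¹ ^ 2 / 16 := by field_simp
  nlinarith [mul_le_mul_of_nonneg_left hinv_sq (sq_nonneg C⁻¹)]

theorem le_minkowskiSymbol (hC : 1 ≤ C) {p : V →L[ℝ] ℝ} (hp : p ≠ 0) :
    finrank ℝ V * (C⁻¹ / 2) ^ 2 * (C⁻¹ ^ 4 / 16) ^ finrank ℝ V * dualGauge N p ^ 2 ≤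
      minkowskiSymbol μ f p := by
  have hC0 : 0 < C := one_pos.trans_le hC
  have hinv : 0 < C⁻¹ := inv_pos.2 hC0
  have hinv_sq : C⁻¹ ^ 2 ≤ 1 := pow_le_one₀ hinv.le (inv_le_one_of_one_le₀ hC)
  wlog hnormalized : dualGauge N p = C⁻¹ / 4 generalizing p
  · have hpos := h.dualGauge_pos hf hC0 hp
    have hscale : 0 < C⁻¹ / 4 / dualGauge N p := by positivity
    have hgauge := dualGauge_smul N hscale.le p
    have hle := this (smul_ne_zero hscale.ne' hp) (by rw [hgauge, div_mul_cancel₀ _ hpos.ne'])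
    rw [hgauge, minkowskiSymbol_smul, mul_pow, mul_left_comm] at hle
    exact le_of_mul_le_mul_left hle (pow_pos hscale 2)
  have hε : C⁻¹ ^ 4 / 16 * C = C⁻¹ ^ 3 / 16 := by field_simp
  have hlt : C⁻¹ ^ 3 / 16 < C⁻¹ / 4 := by nlinarith
  have hball : (C⁻¹ / 4 + C⁻¹ ^ 3 / 16) * C = 1 / 4 + C⁻¹ ^ 2 / 16 := by field_simp
  have hle := h.pow_mul_angleVolume_le μ hf hC0 hp (c := C⁻¹ ^ 4 / 16) (by positivity)
    (by rwa [hε, hnormalized]) (by rw [hε, hnormalized, hball]; linarith)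
    (a := C⁻¹ ^ 2 / 8) (by positivity) fun v hv =>
      h.le_div_of_mem_nearPolar hf hC hp hnormalized (hε ▸ hv)
  rw [minkowskiSymbol, hnormalized, div_mul_eq_mul_div, le_div_iff₀ (hf.angleVolume_pos μ)]
  calc _ = (finrank ℝ V : ℝ) *
        ((C⁻¹ ^ 2 / 8) ^ 2 * (C⁻¹ ^ 4 / 16) ^ finrank ℝ V * angleVolume μ f) := by ring
    _ ≤ _ := mul_le_mul_of_nonneg_left hle (Nat.cast_nonneg _)

theorem minkowskiSymbol_le (hC : 0 < C) {p : V →L[ℝ] ℝ} (hp : p ≠ 0) :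
    minkowskiSymbol μ f p ≤ finrank ℝ V * C ^ 2 * dualGauge N p ^ 2 := by
  have hq := h.dualGauge_pos hf hC hp
  have hpoint (s : Metric.sphere (0 : V) 1) : (p s / f s) ^ 2 * polarJacobian f s ≤
      (C * dualGauge N p) ^ 2 * polarJacobian f s := by
    have hs : (s : V) ≠ 0 := Metric.ne_of_mem_sphere s.2 one_ne_zero
    refine mul_le_mul_of_nonneg_right ?_ (hf.polarJacobian_pos hs).le
    rw [← sq_abs, abs_div, abs_of_pos (hf.pos s hs)]
    refine pow_le_pow_left₀ (by have := hf.pos s hs; positivity) ?_ 2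
    rw [div_le_iff₀ (hf.pos s hs)]
    calc |p s| ≤ dualGauge N p * N s := h.abs_apply_le_dualGauge_mul hf hC hp s
      _ ≤ dualGauge N p * (C * f s) := mul_le_mul_of_nonneg_left (h.gauge_le s) hq.le
      _ = C * dualGauge N p * f s := by ring
  have hint : ∫ s, (p s / f s) ^ 2 * polarJacobian f s ∂μ.toSphere ≤
      (C * dualGauge N p) ^ 2 * angleVolume μ f := by
    rw [angleVolume, ← integral_const_mul]
    exact integral_mono (hf.integrable_mul_polarJacobian μ (hf.continuousOn_div_sq p))
      ((hf.integrable_polarJacobian μ).const_mul _) hpoint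
  rw [minkowskiSymbol, div_mul_eq_mul_div, div_le_iff₀ (hf.angleVolume_pos μ)]
  calc _ ≤ (finrank ℝ V : ℝ) * ((C * dualGauge N p) ^ 2 * angleVolume μ f) :=
        mul_le_mul_of_nonneg_left hint (Nat.cast_nonneg _)
    _ = finrank ℝ V * C ^ 2 * dualGauge N p ^ 2 * angleVolume μ f := by ring

end IsComparableGauge

end MinkowskiSymbol

/-! ### Charts of the tangent bundle -/

variable {d : ℕ} {M : Type*} [TopologicalSpace M] [ChartedSpace (E d) M]
  [IsManifold (𝓡 (d + 1)) ∞ M]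

theorem extChartAt_tangent_apply (q q' : TangentBundle (𝓡 (d + 1)) M) :
    extChartAt (𝓡 (d + 1)).tangent q q' =
      (extChartAt (𝓡 (d + 1)) q.1 q'.1,
        tangentCoordChange (𝓡 (d + 1)) q'.1 q.1 q'.1 q'.2) := rfl

theorem extChartAt_tangent_fiber (x : M) (v w : E d) :
    extChartAt (𝓡 (d + 1)).tangent (⟨x, v⟩ : TangentBundle (𝓡 (d + 1)) M) ⟨x, w⟩ =
      (extChartAt (𝓡 (d + 1)) x x, w) := by
  rw [extChartAt_tangent_apply]
  exact Prod.ext rfl (tangentCoordChange_self (mem_extChartAt_source x))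

theorem extChartAt_tangent_symm_fiber (x : M) (v w : E d) :
    (extChartAt (𝓡 (d + 1)).tangent (⟨x, v⟩ : TangentBundle (𝓡 (d + 1)) M)).symm
      (extChartAt (𝓡 (d + 1)) x x, w) = ⟨x, w⟩ := by
  rw [← extChartAt_tangent_fiber x v w]
  refine (extChartAt (𝓡 (d + 1)).tangent (⟨x, v⟩ : TangentBundle (𝓡 (d + 1)) M)).left_inv ?_
  rw [extChartAt_source, TangentBundle.mem_chart_source_iff]
  exact mem_chart_source _ x

theorem mem_extChartAt_tangent_target (q : TangentBundle (𝓡 (d + 1)) M) (z : E d × E d) :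
    z ∈ (extChartAt (𝓡 (d + 1)).tangent q).target ↔
      z.1 ∈ (extChartAt (𝓡 (d + 1)) q.1).target := by
  simp only [mfld_simps]
  exact TangentBundle.mem_chart_target_iff (I := 𝓡 (d + 1)) z q

theorem isOpen_extChartAt_tangent_target (q : TangentBundle (𝓡 (d + 1)) M) :
    IsOpen (extChartAt (𝓡 (d + 1)).tangent q).target := by
  rw [show (extChartAt (𝓡 (d + 1)).tangent q).target =
      Prod.fst ⁻¹' (extChartAt (𝓡 (d + 1)) q.1).target from
    Set.ext (mem_extChartAt_tangent_target q)]
  exact (isOpen_extChartAt_target q.1).preimage continuous_fst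

theorem mdifferentiableAt_extChartAt_symm {x : M} {y : E d}
    (hy : y ∈ (extChartAt (𝓡 (d + 1)) x).target) :
    MDifferentiableAt 𝓘(ℝ, E d) (𝓡 (d + 1)) (extChartAt (𝓡 (d + 1)) x).symm y :=
  ((contMDiffOn_extChartAt_symm (n := 1) x).contMDiffAt
    ((isOpen_extChartAt_target x).mem_nhds hy)).mdifferentiableAt one_ne_zero

theorem mfderiv_extChartAt_symm {x : M} {y : E d} (hy : y ∈ (extChartAt (𝓡 (d + 1)) x).target) :
    mfderiv 𝓘(ℝ, E d) (𝓡 (d + 1)) (extChartAt (𝓡 (d + 1)) x).symm y =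
      tangentCoordChange (𝓡 (d + 1)) x ((extChartAt (𝓡 (d + 1)) x).symm y)
        ((extChartAt (𝓡 (d + 1)) x).symm y) := by
  rw [(mdifferentiableAt_extChartAt_symm hy).mfderiv, tangentCoordChange_def,
    (extChartAt (𝓡 (d + 1)) x).right_inv hy]
  simp only [writtenInExtChartAt, modelWithCornersSelf_coe, Set.range_id, fderivWithin_univ]
  rfl

theorem mdifferentiableAt_proj (q : TangentBundle (𝓡 (d + 1)) M) :
    MDifferentiableAt (𝓡 (d + 1)).tangent (𝓡 (d + 1))
      (fun q' : TangentBundle (𝓡 (d + 1)) M => q'.1) q :=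
  (Bundle.contMDiff_proj (n := 1) (TangentSpace (𝓡 (d + 1)) : M → Type _)).mdifferentiableAt
    one_ne_zero

theorem mdifferentiableAt_extChartAt_tangent_symm {q : TangentBundle (𝓡 (d + 1)) M}
    {z : E d × E d}
    (hz : z ∈ (extChartAt (𝓡 (d + 1)).tangent q).target) :
    MDifferentiableAt 𝓘(ℝ, E d × E d) (𝓡 (d + 1)).tangent
      (extChartAt (𝓡 (d + 1)).tangent q).symm z :=
  ((contMDiffOn_extChartAt_symm (n := 1) q).contMDiffAt
      ((isOpen_extChartAt_tangent_target q).mem_nhds hz)).mdifferentiableAt one_ne_zero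

theorem dproj_comp_mfderiv_symm {q : TangentBundle (𝓡 (d + 1)) M} {z : E d × E d}
    (hz : z ∈ (extChartAt (𝓡 (d + 1)).tangent q).target) :
    (dproj ((extChartAt (𝓡 (d + 1)).tangent q).symm z)).comp
      (mfderiv 𝓘(ℝ, E d × E d) (𝓡 (d + 1)).tangent
        (extChartAt (𝓡 (d + 1)).tangent q).symm z) =
    (tangentCoordChange (𝓡 (d + 1)) q.1 ((extChartAt (𝓡 (d + 1)) q.1).symm z.1)
      ((extChartAt (𝓡 (d + 1)) q.1).symm z.1)).comp (ContinuousLinearMap.fst ℝ (E d) (E d)) := by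
  have hz1 := (mem_extChartAt_tangent_target q z).1 hz
  have hfst : MDifferentiableAt 𝓘(ℝ, E d × E d) 𝓘(ℝ, E d) (Prod.fst : E d × E d → E d) z :=
    differentiableAt_fst.mdifferentiableAt
  -- Both sides are the derivative of the projection read in the charts, `z ↦ φ⁻¹ z.1`.
  have hproj_comp := mfderiv_comp z (mdifferentiableAt_proj _)
    (mdifferentiableAt_extChartAt_tangent_symm hz)
  have hcomp_fst := mfderiv_comp z (mdifferentiableAt_extChartAt_symm hz1) hfst
  rw [mfderiv_extChartAt_symm hz1, mfderiv_eq_fderiv, fderiv_fst] at hcomp_fst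
  exact hproj_comp.symm.trans hcomp_fst

theorem dproj_apply (q : TangentBundle (𝓡 (d + 1)) M) (Z : TangentSpace (𝓡 (d + 1)).tangent q) :
    dproj q Z = (show E d × E d from Z).1 := by
  have hchart : writtenInExtChartAt (𝓡 (d + 1)).tangent (𝓡 (d + 1)) q
      (fun q' : TangentBundle (𝓡 (d + 1)) M => q'.1) =ᶠ[𝓝 (extChartAt (𝓡 (d + 1)).tangent q q)]
        (Prod.fst : E d × E d → E d) := by
    filter_upwards [(isOpen_extChartAt_tangent_target q).mem_nhds (mem_extChartAt_target q)]
      with z hz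
    exact (extChartAt (𝓡 (d + 1)) q.1).right_inv ((mem_extChartAt_tangent_target q z).1 hz)
  rw [dproj, (mdifferentiableAt_proj q).mfderiv, ModelWithCorners.range_eq_univ, fderivWithin_univ,
    hchart.fderiv_eq, fderiv_fst]
  rfl

theorem contMDiff_fiber (x : M) : ContMDiff 𝓘(ℝ, E d) (𝓡 (d + 1)).tangent ∞
    (fun u : E d => (⟨x, u⟩ : TangentBundle (𝓡 (d + 1)) M)) := by
  have hsymm : (fun u : E d => (⟨x, u⟩ : TangentBundle (𝓡 (d + 1)) M)) =
      (extChartAt (𝓡 (d + 1)).tangent (⟨x, 0⟩ : TangentBundle (𝓡 (d + 1)) M)).symm ∘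
        fun u => (extChartAt (𝓡 (d + 1)) x x, u) := by
    funext u
    exact (extChartAt_tangent_symm_fiber x 0 u).symm
  rw [hsymm]
  intro u
  refine ContMDiffAt.comp u ?_ (contDiff_prodMk_right _).contMDiff.contMDiffAt
  refine (contMDiffOn_extChartAt_symm (⟨x, 0⟩ : TangentBundle (𝓡 (d + 1)) M)).contMDiffAt
    ((isOpen_extChartAt_tangent_target _).mem_nhds ?_)
  rw [mem_extChartAt_tangent_target]
  exact mem_extChartAt_target x

theorem verticalLift_apply (x : M) (v u : E d) :
    verticalLift x v u = (show TangentSpace (𝓡 (d + 1)).tangent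
      (⟨x, v⟩ : TangentBundle (𝓡 (d + 1)) M) from ((0, u) : E d × E d)) := by
  have hdiff : MDifferentiableAt 𝓘(ℝ, E d) (𝓡 (d + 1)).tangent
      (fun u : E d => (⟨x, u⟩ : TangentBundle (𝓡 (d + 1)) M)) v :=
    (contMDiff_fiber x).mdifferentiableAt (by simp)
  have hchart : writtenInExtChartAt 𝓘(ℝ, E d) (𝓡 (d + 1)).tangent v
      (fun u : E d => (⟨x, u⟩ : TangentBundle (𝓡 (d + 1)) M)) =
        fun u => (extChartAt (𝓡 (d + 1)) x x, u) := by
    funext u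
    exact extChartAt_tangent_fiber x v u
  rw [verticalLift, hdiff.mfderiv, hchart, ModelWithCorners.range_eq_univ, fderivWithin_univ]
  exact congrArg (fun L : E d →L[ℝ] E d × E d => L u)
    (hasFDerivAt_prodMk_right (𝕜 := ℝ) (extChartAt (𝓡 (d + 1)) x x) v).fderiv

/-! ### The Hilbert form and its Reeb field -/

theorem extDeriv_ofSubsingleton_apply {V : Type*} [NormedAddCommGroup V] [NormedSpace ℝ V]
    {θ : V → V →L[ℝ] ℝ} {z : V} (hθ : DifferentiableAt ℝ θ z) (Z W : V) :
    extDeriv (fun z => ContinuousAlternatingMap.ofSubsingleton ℝ V ℝ (0 : Fin 1) (θ z)) z ![Z, W] =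
      fderiv ℝ θ z Z W - fderiv ℝ θ z W Z := by
  have hdiff : DifferentiableAt ℝ
      (fun z => ContinuousAlternatingMap.ofSubsingleton ℝ V ℝ (0 : Fin 1) (θ z)) z :=
    (ContinuousAlternatingMap.ofSubsingletonLIE (𝕜 := ℝ) (E := V) (F := ℝ)
      (0 : Fin 1)).differentiableAt.comp z hθ
  have heval (Y : V) : fderiv ℝ (fun z => θ z Y) z = (fderiv ℝ θ z).flip Y := by
    simpa using (hθ.hasFDerivAt.clm_apply (hasFDerivAt_const Y z)).fderiv
  have hW (z : V) : ContinuousAlternatingMap.ofSubsingleton ℝ V ℝ (0 : Fin 1) (θ z)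
      (Fin.removeNth 0 ![Z, W]) = θ z W := rfl
  have hZ (z : V) : ContinuousAlternatingMap.ofSubsingleton ℝ V ℝ (0 : Fin 1) (θ z)
      (Fin.removeNth 1 ![Z, W]) = θ z Z := rfl
  rw [extDeriv_apply hdiff, Fin.sum_univ_two]
  simp only [hW, hZ, heval]
  simp [sub_eq_add_neg]

theorem IsMinkowskiNorm.exists_hess_eq {V : Type*} [NormedAddCommGroup V] [NormedSpace ℝ V]
    [FiniteDimensional ℝ V] {f : V → ℝ} (hf : IsMinkowskiNorm f) {v : V} (hv : v ≠ 0)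
    {ψ : V →L[ℝ] ℝ} (hψ : ψ v = 0) : ∃ η, fderiv ℝ (fderiv ℝ f) v η = ψ := by
  have hfv := hf.pos v hv
  -- Half the Hessian of `f ^ 2` at `v`, which is non-degenerate.
  let B : V →L[ℝ] V →L[ℝ] ℝ :=
    f v • fderiv ℝ (fderiv ℝ f) v + (fderiv ℝ f v).smulRight (fderiv ℝ f v)
  have hB (u w : V) : B u w = f v * fderiv ℝ (fderiv ℝ f) v u w +
      fderiv ℝ f v u * fderiv ℝ f v w := by
    simp [B]
  have hinj : Function.Injective B := by
    refine (injective_iff_map_eq_zero B).2 fun u hu => by_contra fun hu0 => ?_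
    have hBuu := hB u u
    rw [hu, zero_apply] at hBuu
    linarith [hf.hess_sq_pos hv hu0, sq (fderiv ℝ f v u)]
  have hfinrank : Module.finrank ℝ V = Module.finrank ℝ (V →L[ℝ] ℝ) := by
    rw [← (LinearMap.toContinuousLinearMap (𝕜 := ℝ) (E := V) (F' := ℝ)).finrank_eq]
    exact Subspace.dual_finrank_eq.symm
  obtain ⟨η, hη⟩ := (LinearMap.injective_iff_surjective_of_finrank_eq_finrank (f := B.toLinearMap)
    hfinrank).1 hinj (f v • ψ)
  have hη_apply (w : V) : f v * fderiv ℝ (fderiv ℝ f) v η w + fderiv ℝ f v η * fderiv ℝ f v w =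
      f v * ψ w := by
    rw [← hB]
    exact congrArg (fun L : V →L[ℝ] ℝ => L w) hη
  have hdη : fderiv ℝ f v η = 0 := by
    simpa [hf.hess_apply_self hv, hf.fderiv_self hv, hψ, hfv.ne'] using hη_apply v
  refine ⟨η, ContinuousLinearMap.ext fun w => mul_left_cancel₀ hfv.ne' ?_⟩
  simpa [hdη] using hη_apply w

theorem tangentCoordChange_symm_ne_zero {x : M} {y : E d}
    (hy : y ∈ (extChartAt (𝓡 (d + 1)) x).target) {u : E d} (hu : u ≠ 0) :
    tangentCoordChange (𝓡 (d + 1)) x ((extChartAt (𝓡 (d + 1)) x).symm y)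
        ((extChartAt (𝓡 (d + 1)) x).symm y) u ≠ 0 := by
  intro h
  set y' := (extChartAt (𝓡 (d + 1)) x).symm y
  have hs : y' ∈ (extChartAt (𝓡 (d + 1)) x).source := (extChartAt (𝓡 (d + 1)) x).map_target hy
  have hcomp := tangentCoordChange_comp (I := 𝓡 (d + 1)) (w := x) (x := y') (y := x) (z := y')
    (v := u) ⟨⟨hs, mem_extChartAt_source y'⟩, hs⟩
  rw [tangentCoordChange_self hs, h, map_zero] at hcomp
  exact hu hcomp.symm

theorem hilbertForm_apply (F : TangentBundle (𝓡 (d + 1)) M → ℝ) (x : M) (v : E d)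
    (Z : TangentSpace (𝓡 (d + 1)).tangent (⟨x, v⟩ : TangentBundle (𝓡 (d + 1)) M)) :
    hilbertForm F ⟨x, v⟩ Z = fderiv ℝ (fun u : E d => F ⟨x, u⟩) v (show E d × E d from Z).1 := by
  rw [← dproj_apply]
  rfl

/-- The fiber derivative of `F` in the preferred chart of `TM` at `q`. The expression of the Hilbert
form in this chart is `(y, u) ↦ ∑ i, (fiberDeriv F q (y, u)) i dyⁱ`. -/
def fiberDeriv (F : TangentBundle (𝓡 (d + 1)) M → ℝ) (q : TangentBundle (𝓡 (d + 1)) M)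
    (z : E d × E d) : E d →L[ℝ] ℝ :=
  (fderiv ℝ (fun z : E d × E d => F ((extChartAt (𝓡 (d + 1)).tangent q).symm z)) z).comp
    (ContinuousLinearMap.inr ℝ (E d) (E d))

/-- The part of the chart of `TM` at `q` that lies off the zero section. -/
def slitTarget (q : TangentBundle (𝓡 (d + 1)) M) : Set (E d × E d) :=
  (extChartAt (𝓡 (d + 1)).tangent q).target ∩ {z | z.2 ≠ 0}

theorem isOpen_slitTarget (q : TangentBundle (𝓡 (d + 1)) M) : IsOpen (slitTarget q) :=
  (isOpen_extChartAt_tangent_target q).inter (isOpen_ne.preimage continuous_snd)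

theorem mem_slitTarget_fiber (x : M) (v : E d) {w : E d} (hw : w ≠ 0) :
    (extChartAt (𝓡 (d + 1)) x x, w) ∈
      slitTarget (⟨x, v⟩ : TangentBundle (𝓡 (d + 1)) M) :=
  ⟨(mem_extChartAt_tangent_target _ _).2 (mem_extChartAt_target x), hw⟩

namespace IsFinslerMetric

variable {F : TangentBundle (𝓡 (d + 1)) M → ℝ} (hF : IsFinslerMetric F)
include hF

theorem isMinkowskiNorm (x : M) : IsMinkowskiNorm (fun u : E d => F ⟨x, u⟩) where
  smooth := by
    rw [← contMDiffOn_iff_contDiffOn]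
    exact hF.smooth.comp (contMDiff_fiber x).contMDiffOn fun u hu => hu
  homogeneous v c hc := hF.homogeneous x v c hc
  pos v hv := lt_of_le_of_ne (hF.nonneg _) fun h => hv ((hF.eq_zero_iff x v).1 h.symm)
  stronglyConvex v w hv hw := hF.stronglyConvex x v w hv hw

theorem contDiffOn_chart (q : TangentBundle (𝓡 (d + 1)) M) :
    ContDiffOn ℝ ∞ (fun z : E d × E d => F ((extChartAt (𝓡 (d + 1)).tangent q).symm z))
      (slitTarget q) := by
  rw [← contMDiffOn_iff_contDiffOn]
  refine hF.smooth.comp ((contMDiffOn_extChartAt_symm q).mono Set.inter_subset_left) ?_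
  rintro z ⟨hz, hz2⟩
  exact tangentCoordChange_symm_ne_zero ((mem_extChartAt_tangent_target q z).1 hz) hz2

theorem hasFDerivAt_fiberDeriv {q : TangentBundle (𝓡 (d + 1)) M} {y u : E d}
    (hz : (y, u) ∈ slitTarget q) :
    HasFDerivAt (fun w : E d => F ((extChartAt (𝓡 (d + 1)).tangent q).symm (y, w)))
      (fiberDeriv F q (y, u)) u :=
  (((hF.contDiffOn_chart q).contDiffAt ((isOpen_slitTarget q).mem_nhds hz)).differentiableAt
    (by simp)).hasFDerivAt.comp u (hasFDerivAt_prodMk_right y u)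

theorem differentiableAt_fiberDeriv {q : TangentBundle (𝓡 (d + 1)) M} {z : E d × E d}
    (hz : z ∈ slitTarget q) : DifferentiableAt ℝ (fiberDeriv F q) z :=
  ((((hF.contDiffOn_chart q).fderiv_of_isOpen (isOpen_slitTarget q) (m := ∞) (by simp)).contDiffAt
    ((isOpen_slitTarget q).mem_nhds hz)).differentiableAt (by simp)).clm_comp
      (differentiableAt_const _)

theorem fderiv_fiberDeriv_vertical (x : M) {v : E d} (hv : v ≠ 0) (u : E d) :
    fderiv ℝ (fiberDeriv F ⟨x, v⟩) (extChartAt (𝓡 (d + 1)) x x, v) (0, u) =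
      fderiv ℝ (fderiv ℝ (fun u : E d => F ⟨x, u⟩)) v u := by
  have hfiber : (fun w : E d => fiberDeriv F ⟨x, v⟩ (extChartAt (𝓡 (d + 1)) x x, w)) =ᶠ[𝓝 v]
      fderiv ℝ (fun u : E d => F ⟨x, u⟩) := by
    filter_upwards [isOpen_ne.mem_nhds hv] with w hw
    have hderiv := hF.hasFDerivAt_fiberDeriv (mem_slitTarget_fiber x v hw)
    simp only [extChartAt_tangent_symm_fiber] at hderiv
    exact hderiv.fderiv.symm
  have hcomp := (hF.differentiableAt_fiberDeriv (mem_slitTarget_fiber x v hv)).hasFDerivAt.comp v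
    (hasFDerivAt_prodMk_right (𝕜 := ℝ) (extChartAt (𝓡 (d + 1)) x x) v)
  rw [← hfiber.fderiv_eq]
  exact congrArg (fun L : E d →L[ℝ] E d →L[ℝ] ℝ => L u) hcomp.fderiv.symm

theorem hilbertForm_comp_mfderiv_symm {q : TangentBundle (𝓡 (d + 1)) M} {z : E d × E d}
    (hz : z ∈ slitTarget q) :
    (hilbertForm F ((extChartAt (𝓡 (d + 1)).tangent q).symm z)).comp
      (mfderiv 𝓘(ℝ, E d × E d) (𝓡 (d + 1)).tangent
        (extChartAt (𝓡 (d + 1)).tangent q).symm z) =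
    (fiberDeriv F q z).comp (ContinuousLinearMap.fst ℝ (E d) (E d)) := by
  set y := (extChartAt (𝓡 (d + 1)) q.1).symm z.1
  set T := tangentCoordChange (𝓡 (d + 1)) q.1 y y
  have hT : T z.2 ≠ 0 :=
    tangentCoordChange_symm_ne_zero ((mem_extChartAt_tangent_target q z).1 hz.1) hz.2
  have hchain : HasFDerivAt (fun u : E d => F ⟨y, T u⟩)
      ((fderiv ℝ (fun u : E d => F ⟨y, u⟩) (T z.2)).comp T) z.2 :=
    ((hF.isMinkowskiNorm y).differentiableAt hT).hasFDerivAt.comp z.2 T.hasFDerivAt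
  rw [(hF.hasFDerivAt_fiberDeriv hz).unique hchain]
  exact congrArg
    (fun L : E d × E d →L[ℝ] E d => (fderiv ℝ (fun u : E d => F ⟨y, u⟩) (T z.2)).comp L)
    (dproj_comp_mfderiv_symm hz.1)

theorem extDerivOneForm_hilbertForm (x : M) {v : E d} (hv : v ≠ 0) (Z W : E d × E d) :
    extDerivOneForm (hilbertForm F) (⟨x, v⟩ : TangentBundle (𝓡 (d + 1)) M) ![Z, W] =
      fderiv ℝ (fiberDeriv F ⟨x, v⟩) (extChartAt (𝓡 (d + 1)) x x, v) Z W.1 -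
        fderiv ℝ (fiberDeriv F ⟨x, v⟩) (extChartAt (𝓡 (d + 1)) x x, v) W Z.1 := by
  set q : TangentBundle (𝓡 (d + 1)) M := ⟨x, v⟩
  set z₀ : E d × E d := (extChartAt (𝓡 (d + 1)) x x, v)
  have hz₀ : z₀ ∈ slitTarget q := mem_slitTarget_fiber x v hv
  have hdiff := hF.differentiableAt_fiberDeriv hz₀
  have hchart : (fun z : E d × E d => ContinuousAlternatingMap.ofSubsingleton ℝ (E d × E d) ℝ
      (0 : Fin 1) ((hilbertForm F ((extChartAt (𝓡 (d + 1)).tangent q).symm z)).comp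
      (mfderiv 𝓘(ℝ, E d × E d) (𝓡 (d + 1)).tangent
        (extChartAt (𝓡 (d + 1)).tangent q).symm z))) =ᶠ[𝓝 z₀]
      fun z => ContinuousAlternatingMap.ofSubsingleton ℝ (E d × E d) ℝ (0 : Fin 1)
        ((fiberDeriv F q z).comp (ContinuousLinearMap.fst ℝ (E d) (E d))) := by
    filter_upwards [(isOpen_slitTarget q).mem_nhds hz₀] with z hz
    exact congrArg (ContinuousAlternatingMap.ofSubsingleton ℝ (E d × E d) ℝ (0 : Fin 1))
      (hF.hilbertForm_comp_mfderiv_symm hz)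
  have hfderiv (Y : E d × E d) :
      fderiv ℝ (fun z => (fiberDeriv F q z).comp (ContinuousLinearMap.fst ℝ (E d) (E d))) z₀ Y =
        (fderiv ℝ (fiberDeriv F q) z₀ Y).comp (ContinuousLinearMap.fst ℝ (E d) (E d)) := by
    rw [fderiv_clm_comp hdiff (differentiableAt_const _)]
    simp
  have hext := extDeriv_ofSubsingleton_apply
    (hdiff.clm_comp (differentiableAt_const (ContinuousLinearMap.fst ℝ (E d) (E d)))) Z W
  rw [hfderiv, hfderiv, ← hchart.extDeriv_eq] at hext
  refine Eq.trans ?_ hext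
  rw [extDerivOneForm, extChartAt_tangent_fiber]
  rfl

theorem exists_extDerivOneForm_hilbertForm_eq (x : M) {v : E d} (hv : v ≠ 0) :
    ∃ b : E d × E d →L[ℝ] (E d →L[ℝ] ℝ),
      (∀ u, b (0, u) = fderiv ℝ (fderiv ℝ (fun u : E d => F ⟨x, u⟩)) v u) ∧
      ∀ Z W : E d × E d,
        extDerivOneForm (hilbertForm F) (⟨x, v⟩ : TangentBundle (𝓡 (d + 1)) M) ![Z, W] =
          b Z W.1 - b W Z.1 :=
  ⟨_, hF.fderiv_fiberDeriv_vertical x hv, hF.extDerivOneForm_hilbertForm x hv⟩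

theorem exists_isReebVector (x : M) {v : E d} (hv : v ≠ 0) :
    ∃ Z, IsReebVector F (⟨x, v⟩ : TangentBundle (𝓡 (d + 1)) M) Z := by
  have hf := hF.isMinkowskiNorm x
  set f : E d → ℝ := fun u => F ⟨x, u⟩
  obtain ⟨b, hb, hext⟩ := hF.exists_extDerivOneForm_hilbertForm_eq x hv
  have hsplit (ξ η : E d) : b (ξ, η) = b (ξ, 0) + fderiv ℝ (fderiv ℝ f) v η := by
    rw [← hb η, ← map_add, Prod.mk_add_mk, add_zero, zero_add]
  set ξ : E d := (f v)⁻¹ • v with hξ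
  have hξ_hess (u : E d) : fderiv ℝ (fderiv ℝ f) v u ξ = 0 := by
    rw [hξ, map_smul, hf.hess_apply_self hv, smul_zero]
  -- A vector `(ξ, η)` annihilates `dA` when `D²f(η, ·) = ψ`.
  set ψ : E d →L[ℝ] ℝ :=
    (b.comp (ContinuousLinearMap.inl ℝ (E d) (E d))).flip ξ - b (ξ, 0)
  have hψ_apply (w : E d) : ψ w = b (w, 0) ξ - b (ξ, 0) w := rfl
  have hψv : ψ v = 0 := by
    have hξv : ((ξ, 0) : E d × E d) = (f v)⁻¹ • ((v, 0) : E d × E d) := by simp [hξ]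
    rw [hψ_apply, hξv, map_smul, map_smul, smul_apply, sub_self]
  obtain ⟨η, hη⟩ := hf.exists_hess_eq hv hψv
  refine ⟨((ξ, η) : E d × E d), ?_, fun W => ?_⟩
  · refine (hilbertForm_apply F x v _).trans ?_
    change fderiv ℝ f v ξ = 1
    rw [hξ, map_smul, hf.fderiv_self hv, smul_eq_mul, inv_mul_cancel₀ (hf.pos v hv).ne']
  · obtain ⟨ξ', η'⟩ : E d × E d := W
    refine (hext (ξ, η) (ξ', η')).trans ?_
    simp only [hsplit ξ η, hsplit ξ' η', hη, _root_.add_apply, hξ_hess, hψ_apply]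
    ring

theorem fst_of_isReebVector (x : M) {v : E d} (hv : v ≠ 0)
    {Z : TangentSpace (𝓡 (d + 1)).tangent (⟨x, v⟩ : TangentBundle (𝓡 (d + 1)) M)}
    (hZ : IsReebVector F (⟨x, v⟩ : TangentBundle (𝓡 (d + 1)) M) Z) :
    (show E d × E d from Z).1 = (F ⟨x, v⟩)⁻¹ • v := by
  have hf := hF.isMinkowskiNorm x
  obtain ⟨b, hb, hext⟩ := hF.exists_extDerivOneForm_hilbertForm_eq x hv
  obtain ⟨ξ, η⟩ : E d × E d := Z
  have hhess : fderiv ℝ (fderiv ℝ (fun u : E d => F ⟨x, u⟩)) v ξ ξ = 0 := by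
    have hdA := (hext (ξ, η) (0, ξ)).symm.trans (hZ.2 ((0, ξ) : E d × E d))
    rwa [hb, map_zero, zero_sub, neg_eq_zero] at hdA
  obtain ⟨c, rfl⟩ : ∃ c : ℝ, c • v = ξ := by
    have hdep : ¬ LinearIndependent ℝ ![v, ξ] := fun hli => (hf.hess_pos hli).ne' hhess
    simpa [LinearIndependent.pair_iff' hv] using hdep
  have hA := (hilbertForm_apply F x v _).symm.trans hZ.1
  change fderiv ℝ (fun u : E d => F ⟨x, u⟩) v (c • v) = 1 at hA
  rw [map_smul, hf.fderiv_self hv, smul_eq_mul] at hA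
  change c • v = _
  rw [eq_inv_of_mul_eq_one_left hA]

theorem dproj_reebField {q : TangentBundle (𝓡 (d + 1)) M} (hq : q.2 ≠ 0) :
    dproj q (reebField F q) = (F q)⁻¹ • q.2 := by
  rw [dproj_apply]
  exact hF.fst_of_isReebVector q.1 hq (Classical.epsilon_spec (hF.exists_isReebVector q.1 hq))

end IsFinslerMetric

/-! ### Lie derivatives along the Reeb field -/

section LieDerivative

variable {F g h : TangentBundle (𝓡 (d + 1)) M → ℝ} {q : TangentBundle (𝓡 (d + 1)) M}

theorem lieReeb_congr (hgh : g =ᶠ[𝓝 q] h) : lieReeb F g q = lieReeb F h q :=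
  congrArg (fun L : E d × E d →L[ℝ] ℝ => L (reebField F q)) hgh.mfderiv_eq

theorem lieReeb_mul (hg : MDifferentiableAt (𝓡 (d + 1)).tangent 𝓘(ℝ, ℝ) g q)
    (hh : MDifferentiableAt (𝓡 (d + 1)).tangent 𝓘(ℝ, ℝ) h q) :
    lieReeb F (g * h) q = g q * lieReeb F h q + h q * lieReeb F g q :=
  congrArg (fun L : E d × E d →L[ℝ] ℝ => L (reebField F q))
    (hg.hasMFDerivAt.mul hh.hasMFDerivAt).mfderiv

theorem lieReeb_lieReeb_sq_of_eq_zero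
    (hh : ∀ᶠ q' in 𝓝 q, MDifferentiableAt (𝓡 (d + 1)).tangent 𝓘(ℝ, ℝ) h q')
    (hLh : MDifferentiableAt (𝓡 (d + 1)).tangent 𝓘(ℝ, ℝ) (lieReeb F h) q) (hq : h q = 0) :
    lieReeb F (lieReeb F (fun q' => h q' ^ 2)) q = 2 * lieReeb F h q ^ 2 := by
  have hfirst : lieReeb F (fun q' => h q' ^ 2) =ᶠ[𝓝 q] h * (lieReeb F h + lieReeb F h) := by
    filter_upwards [hh] with q' hq'
    rw [show (fun q' => h q' ^ 2) = h * h from funext fun q' => sq (h q'), lieReeb_mul hq' hq']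
    simp only [Pi.mul_apply, Pi.add_apply, mul_add]
  rw [lieReeb_congr hfirst, lieReeb_mul hh.self_of_nhds (hLh.add hLh), hq, Pi.add_apply]
  ring

end LieDerivative

/-- The differential of `φ`, as a fiberwise linear function `(x, v) ↦ dφ_x(v)` on `TM`. -/
def fiberwiseDifferential (φ : M → ℝ) (q : TangentBundle (𝓡 (d + 1)) M) : ℝ :=
  mfderiv (𝓡 (d + 1)) 𝓘(ℝ, ℝ) φ q.1 q.2

theorem mdifferentiableAt_fiberwiseDifferential {φ : M → ℝ} {q : TangentBundle (𝓡 (d + 1)) M}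
    (hφ : ContMDiffAt (𝓡 (d + 1)) 𝓘(ℝ, ℝ) 2 φ q.1) :
    MDifferentiableAt (𝓡 (d + 1)).tangent 𝓘(ℝ, ℝ) (fiberwiseDifferential φ) q := by
  have : IsManifold (𝓡 (d + 1)) 2 M :=
    IsManifold.of_le (n := ∞) (WithTop.coe_le_coe.2 le_top)
  obtain ⟨u, hu, hφu⟩ := (contMDiffAt_iff_contMDiffOn_nhds (n := 2) (by decide)).1 hφ
  obtain ⟨U, hUu, hUo, hqU⟩ := mem_nhds_iff.1 hu
  have hpreimage : Bundle.TotalSpace.proj ⁻¹' U ∈ 𝓝 q :=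
    (hUo.preimage (FiberBundle.continuous_proj (E d)
      (TangentSpace (𝓡 (d + 1)) : M → Type _))).mem_nhds hqU
  have htangentMap := (((hφu.mono hUu).contMDiffOn_tangentMapWithin (m := 1) (by norm_num)
    hUo.uniqueMDiffOn).contMDiffAt hpreimage).mdifferentiableAt one_ne_zero
  have hsnd : MDifferentiableAt 𝓘(ℝ, ℝ).tangent 𝓘(ℝ, ℝ)
      (fun p : TangentBundle 𝓘(ℝ, ℝ) ℝ => (p.2 : ℝ))
      (tangentMapWithin (𝓡 (d + 1)) 𝓘(ℝ, ℝ) φ U q) :=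
    (contMDiff_snd_tangentBundle_modelSpace ℝ 𝓘(ℝ, ℝ) (n := 1)).mdifferentiableAt one_ne_zero
  refine (hsnd.comp q htangentMap).congr_of_eventuallyEq ?_
  filter_upwards [hpreimage] with q' hq'
  exact congrArg (fun L : E d →L[ℝ] ℝ => L q'.2)
    (mfderivWithin_of_isOpen (I := 𝓡 (d + 1)) (I' := 𝓘(ℝ, ℝ)) (f := φ) hUo hq').symm

namespace IsFinslerMetric

variable {F : TangentBundle (𝓡 (d + 1)) M → ℝ} (hF : IsFinslerMetric F)
include hF

theorem pos {q : TangentBundle (𝓡 (d + 1)) M} (hq : q.2 ≠ 0) : 0 < F q :=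
  (hF.isMinkowskiNorm q.1).pos q.2 hq

theorem eventually_ne_zero {q : TangentBundle (𝓡 (d + 1)) M} (hq : q.2 ≠ 0) :
    ∀ᶠ q' in 𝓝 q, q'.2 ≠ 0 := by
  filter_upwards [hF.continuous.continuousAt.eventually_ne (hF.pos hq).ne'] with q' hq' h
  exact hq' ((hF.eq_zero_iff q'.1 q'.2).2 h)

theorem mdifferentiableAt {q : TangentBundle (𝓡 (d + 1)) M} (hq : q.2 ≠ 0) :
    MDifferentiableAt (𝓡 (d + 1)).tangent 𝓘(ℝ, ℝ) F q :=
  (hF.smooth.contMDiffAt (hF.eventually_ne_zero hq)).mdifferentiableAt (by simp)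

theorem lieReeb_comp_proj {φ : M → ℝ} {q : TangentBundle (𝓡 (d + 1)) M} (hq : q.2 ≠ 0)
    (hφ : MDifferentiableAt (𝓡 (d + 1)) 𝓘(ℝ, ℝ) φ q.1) :
    lieReeb F (fun q' : TangentBundle (𝓡 (d + 1)) M => φ q'.1) q =
      fiberwiseDifferential φ q / F q := by
  have hderiv : HasMFDerivAt (𝓡 (d + 1)).tangent 𝓘(ℝ, ℝ)
      (fun q' : TangentBundle (𝓡 (d + 1)) M => φ q'.1) q
      ((mfderiv (𝓡 (d + 1)) 𝓘(ℝ, ℝ) φ q.1).comp (dproj q)) :=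
    HasMFDerivAt.comp q hφ.hasMFDerivAt (mdifferentiableAt_proj q).hasMFDerivAt
  rw [lieReeb, hderiv.mfderiv]
  change mfderiv (𝓡 (d + 1)) 𝓘(ℝ, ℝ) φ q.1 (dproj q (reebField F q)) = _
  rw [hF.dproj_reebField hq, map_smul]
  exact inv_mul_eq_div (F q) (fiberwiseDifferential φ q)

theorem lieReeb_lieReeb_sq {φ : M → ℝ} {x : M} (hφ : ContMDiffAt (𝓡 (d + 1)) 𝓘(ℝ, ℝ) 2 φ x)
    (hφx : φ x = 0) {v : E d} (hv : v ≠ 0) :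
    lieReeb F (lieReeb F (fun q : TangentBundle (𝓡 (d + 1)) M => φ q.1 ^ 2)) ⟨x, v⟩ =
      2 * (fiberwiseDifferential φ ⟨x, v⟩ / F ⟨x, v⟩) ^ 2 := by
  set q : TangentBundle (𝓡 (d + 1)) M := ⟨x, v⟩
  have hq : q.2 ≠ 0 := hv
  have : IsManifold (𝓡 (d + 1)) 2 M := IsManifold.of_le (n := ∞) (WithTop.coe_le_coe.2 le_top)
  have hφ_nhds : ∀ᶠ q' in 𝓝 q, MDifferentiableAt (𝓡 (d + 1)) 𝓘(ℝ, ℝ) φ q'.1 := by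
    have hproj : Filter.Tendsto (fun q' : TangentBundle (𝓡 (d + 1)) M => q'.1) (𝓝 q) (𝓝 x) :=
      (FiberBundle.continuous_proj (E d) (TangentSpace (𝓡 (d + 1)) : M → Type _)).continuousAt
    filter_upwards [hproj.eventually
      ((contMDiffAt_iff_contMDiffAt_nhds (n := 2) (by decide)).1 hφ)] with q' hq'
    exact hq'.mdifferentiableAt two_ne_zero
  have hfirst : lieReeb F (fun q' => φ q'.1) =ᶠ[𝓝 q] fun q' =>
      fiberwiseDifferential φ q' / F q' := by
    filter_upwards [hφ_nhds, hF.eventually_ne_zero hq] with q' hφq' hq'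
    exact hF.lieReeb_comp_proj hq' hφq'
  have hfirst_diff := ((mdifferentiableAt_fiberwiseDifferential (q := q) hφ).div
    (hF.mdifferentiableAt hq) (hF.pos hq).ne').congr_of_eventuallyEq hfirst
  rw [lieReeb_lieReeb_sq_of_eq_zero (h := fun q' => φ q'.1) ?_ hfirst_diff hφx, hfirst.eq_of_nhds]
  filter_upwards [hφ_nhds] with q' hφq'
  exact MDifferentiableAt.comp q' hφq' (mdifferentiableAt_proj q')

end IsFinslerMetric

/-! ### The angle form and the symbol of the Finsler-Laplacian -/

section AngleForm

open MeasureTheory Module Matrix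

theorem dotProduct_ofLp (ξ : E d →L[ℝ] ℝ) (w : E d) :
    (fun k => ξ (EuclideanSpace.single k 1)) ⬝ᵥ w.ofLp = ξ w := by
  simpa [dotProduct, EuclideanSpace.inner_single_left] using
    sum_apply_mul_inner (EuclideanSpace.basisFun (Fin (d + 1)) ℝ) ξ w

/-- The angle form of `f` at `v`, up to a constant: the determinant with first row `df_v` and
further rows `D²f_v(u i, ·)`. -/
def angleDet (f : E d → ℝ) (v : E d) (u : Fin d → E d) : ℝ :=
  det (of (Fin.cons (fun k => fderiv ℝ f v (EuclideanSpace.single k 1))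
    fun i k => fderiv ℝ (fderiv ℝ f) v (u i) (EuclideanSpace.single k 1)))

theorem IsMinkowskiNorm.sphereDensity_angleDet {f : E d → ℝ} (hf : IsMinkowskiNorm f) {s : E d}
    (hs : ‖s‖ = 1) : sphereDensity (angleDet f s) s = polarJacobian f s := by
  have hs0 : s ≠ 0 := norm_ne_zero_iff.1 (hs ▸ one_ne_zero)
  let b := EuclideanSpace.basisFun (Fin (d + 1)) ℝ
  rw [hf.polarJacobian_eq b hs, ← sum_mul_det_cons_succAbove _ (hf.det_hessMatrix b hs0)]
  simp only [b, EuclideanSpace.basisFun_apply, EuclideanSpace.inner_single_left, map_one, one_mul,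
    hessMatrix]
  rfl

theorem sphereDensity_const_mul (c : ℝ) (β : (Fin d → E d) → ℝ) (s : E d) :
    sphereDensity (fun u => c * β u) s = c * sphereDensity β s := by
  simp only [sphereDensity, Finset.mul_sum, mul_left_comm c]

theorem sphereVolume_pos : 0 < sphereVolume d :=
  ENNReal.toReal_pos (Measure.measure_univ_ne_zero.2 (Measure.toSphere_ne_zero _))
    (measure_ne_top _ _)

/-- The volume form of `T_xM ≅ ℝⁿ` that takes the value `1` on the standard basis. -/
def coordVolume (x : M) : TangentSpace (𝓡 (d + 1)) x [⋀^Fin (d + 1)]→ₗ[ℝ] ℝ :=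
  (EuclideanSpace.basisFun (Fin (d + 1)) ℝ).toBasis.det

theorem dproj_verticalLift (x : M) (v u : E d) :
    dproj (⟨x, v⟩ : TangentBundle (𝓡 (d + 1)) M) (verticalLift x v u) = 0 := by
  rw [verticalLift_apply, dproj_apply]
  rfl

theorem wedge_verticalLift (x : M) (v : E d) (u : Fin d → E d)
    (α : TangentSpace (𝓡 (d + 1)).tangent (⟨x, v⟩ : TangentBundle (𝓡 (d + 1)) M)
      [⋀^Fin d]→ₗ[ℝ] ℝ) (Ω : TangentSpace (𝓡 (d + 1)) x [⋀^Fin (d + 1)]→ₗ[ℝ] ℝ) :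
    wedge α (Ω.compLinearMap (dproj (⟨x, v⟩ : TangentBundle (𝓡 (d + 1)) M)).toLinearMap)
      (Fin.append (fun i => verticalLift x v (u i))
        (fun j => ((EuclideanSpace.basisFun (Fin (d + 1)) ℝ j, 0) : E d × E d))) =
      α (fun i => verticalLift x v (u i)) *
        Ω (EuclideanSpace.basisFun (Fin (d + 1)) ℝ).toBasis := by
  refine (wedge_append α _ _ _ fun Y i j hY => ?_).trans ?_
  · refine Ω.map_coord_zero j ?_
    rw [hY]
    exact dproj_verticalLift x v (u i)
  · rw [OrthonormalBasis.coe_toBasis]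
    exact congrArg (α (fun i => verticalLift x v (u i)) * Ω ·) (funext fun j => dproj_apply _ _)

/-- The bordered determinant `β` with `β ∧ π^*vol = A ∧ (dA)^{n-1}` at `(x, v)` up to a constant,
where `vol` is the volume form `coordVolume x`. -/
def angleFactor (F : TangentBundle (𝓡 (d + 1)) M → ℝ) (x : M) (v : E d) :
    TangentSpace (𝓡 (d + 1)).tangent (⟨x, v⟩ : TangentBundle (𝓡 (d + 1)) M) [⋀^Fin d]→ₗ[ℝ] ℝ :=
  borderedDet (V := E d × E d)
    (fun k => fderiv ℝ (fun u : E d => F ⟨x, u⟩) v (EuclideanSpace.single k 1))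
    (LinearMap.pi fun k => ((fderiv ℝ (fiberDeriv F ⟨x, v⟩) (extChartAt (𝓡 (d + 1)) x x, v)).flip
      (EuclideanSpace.single k 1)).toLinearMap)

theorem fiberIntegral_eq_mul {F : TangentBundle (𝓡 (d + 1)) M → ℝ} {x : M}
    (hf : IsMinkowskiNorm fun u : E d => F ⟨x, u⟩)
    {α : ∀ v : E d, TangentSpace (𝓡 (d + 1)).tangent (⟨x, v⟩ : TangentBundle (𝓡 (d + 1)) M)
      [⋀^Fin d]→ₗ[ℝ] ℝ} {κ : ℝ}
    (hα : ∀ v, v ≠ 0 → ∀ u : Fin d → E d,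
      α v (fun i => verticalLift x v (u i)) = κ * angleDet (fun w => F ⟨x, w⟩) v u)
    (h : TangentBundle (𝓡 (d + 1)) M → ℝ) :
    fiberIntegral x h α = κ * ∫ s : Metric.sphere (0 : E d) 1,
      h ⟨x, (s : E d)⟩ * polarJacobian (fun w : E d => F ⟨x, w⟩) s ∂volume.toSphere := by
  rw [fiberIntegral, ← integral_const_mul]
  congr 1 with s
  have hs : ‖(s : E d)‖ = 1 := norm_eq_of_mem_sphere s
  rw [funext (hα s (Metric.ne_of_mem_sphere s.2 one_ne_zero)), sphereDensity_const_mul,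
    hf.sphereDensity_angleDet hs, mul_left_comm]

namespace IsFinslerMetric

variable {F : TangentBundle (𝓡 (d + 1)) M → ℝ} (hF : IsFinslerMetric F)
include hF

theorem angleFactor_verticalLift (x : M) {v : E d} (hv : v ≠ 0) (u : Fin d → E d) :
    angleFactor F x v (fun i => verticalLift x v (u i)) = angleDet (fun w => F ⟨x, w⟩) v u := by
  refine (borderedDet_apply _ _ _).trans ?_
  unfold angleDet
  congr 3
  funext i k
  rw [← hF.fderiv_fiberDeriv_vertical x hv (u i), verticalLift_apply]
  rfl

theorem contactForm_eq_wedge (x : M) {v : E d} (hv : v ≠ 0)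
    (W : Fin (d + (d + 1)) →
      TangentSpace (𝓡 (d + 1)).tangent (⟨x, v⟩ : TangentBundle (𝓡 (d + 1)) M)) :
    contactForm F ⟨x, v⟩ W = ((Equiv.Perm.sign (shuffle d) : ℤ) : ℝ) * d.factorial *
      wedge (angleFactor F x v) ((coordVolume x).compLinearMap
        (dproj (⟨x, v⟩ : TangentBundle (𝓡 (d + 1)) M)).toLinearMap) W := by
  let π : E d × E d →ₗ[ℝ] (Fin (d + 1) → ℝ) :=
    (WithLp.linearEquiv 2 ℝ (Fin (d + 1) → ℝ)).toLinearMap ∘ₗ LinearMap.fst ℝ (E d) (E d)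
  have hvol : detRowAlternating.compLinearMap π = (coordVolume x).compLinearMap
      (dproj (⟨x, v⟩ : TangentBundle (𝓡 (d + 1)) M)).toLinearMap := by
    ext Y
    have hY : (fun j => dproj (⟨x, v⟩ : TangentBundle (𝓡 (d + 1)) M) (Y j)) = fun j => (Y j).1 :=
      funext fun j => dproj_apply _ _
    change _ = (EuclideanSpace.basisFun (Fin (d + 1)) ℝ).toBasis.det
      (fun j => dproj (⟨x, v⟩ : TangentBundle (𝓡 (d + 1)) M) (Y j))
    rw [hY, Basis.det_apply, ← det_transpose]
    rfl
  rw [← hvol]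
  refine wedgeOnePowTwo_eq_wedge (V := E d × E d) (π := π) (fun Z => ?_) (fun Z Y => ?_) W
  · exact (hilbertForm_apply F x v Z).trans (dotProduct_ofLp _ Z.1).symm
  · exact (hF.extDerivOneForm_hilbertForm x hv Z Y).trans
      (congrArg₂ _ (dotProduct_ofLp _ Y.1).symm (dotProduct_ofLp _ Z.1).symm)

theorem exists_eq_mul_angleDet {x : M}
    {Ω : TangentSpace (𝓡 (d + 1)) x [⋀^Fin (d + 1)]→ₗ[ℝ] ℝ}
    {α : ∀ v : E d, TangentSpace (𝓡 (d + 1)).tangent (⟨x, v⟩ : TangentBundle (𝓡 (d + 1)) M)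
      [⋀^Fin d]→ₗ[ℝ] ℝ} (h : IsVolumeAngle F x Ω α) :
    ∃ κ : ℝ, ∀ v, v ≠ 0 → ∀ u : Fin d → E d,
      α v (fun i => verticalLift x v (u i)) = κ * angleDet (fun w => F ⟨x, w⟩) v u := by
  have hΩ : Ω (EuclideanSpace.basisFun (Fin (d + 1)) ℝ).toBasis ≠ 0 :=
    (AlternatingMap.map_basis_ne_zero_iff (M := E d) _ Ω).2 h.volume_ne_zero
  refine ⟨((Equiv.Perm.sign (shuffle d) : ℤ) : ℝ) * d.factorial /
    Ω (EuclideanSpace.basisFun (Fin (d + 1)) ℝ).toBasis, fun v hv u => ?_⟩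
  have hvol : coordVolume x (EuclideanSpace.basisFun (Fin (d + 1)) ℝ).toBasis = 1 :=
    Basis.det_self _
  have heval := h.wedge_eq v hv (Fin.append (fun i => verticalLift x v (u i))
    (fun j => ((EuclideanSpace.basisFun (Fin (d + 1)) ℝ j, 0) : E d × E d)))
  rw [hF.contactForm_eq_wedge x hv, wedge_verticalLift, wedge_verticalLift,
    hF.angleFactor_verticalLift x hv, hvol, mul_one] at heval
  rw [div_mul_eq_mul_div, eq_div_iff hΩ]
  exact heval

theorem exists_isVolumeAngle (x : M) : ∃ α Ω, IsVolumeAngle F x Ω α := by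
  have hf := hF.isMinkowskiNorm x
  set f : E d → ℝ := fun u => F ⟨x, u⟩
  set κ := sphereVolume d / angleVolume volume f
  have hJ : 0 < angleVolume volume f := hf.angleVolume_pos volume
  have hκ0 : κ ≠ 0 := (div_pos sphereVolume_pos hJ).ne'
  refine ⟨fun v => κ • angleFactor F x v,
    (((Equiv.Perm.sign (shuffle d) : ℤ) : ℝ) * d.factorial / κ) • coordVolume x, ?_, ?_, ?_⟩
  · have hsign : ((Equiv.Perm.sign (shuffle d) : ℤ) : ℝ) ≠ 0 := by simp
    exact smul_ne_zero (div_ne_zero (mul_ne_zero hsign (by positivity)) hκ0)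
      (Basis.det_ne_zero (EuclideanSpace.basisFun (Fin (d + 1)) ℝ).toBasis)
  · intro v hv W
    rw [wedge_smul_compLinearMap_smul, hF.contactForm_eq_wedge x hv, mul_div_cancel₀ _ hκ0]
  · rw [fiberIntegral_eq_mul hf (κ := κ) fun v hv u => ?_]
    · simp only [one_mul]
      exact div_mul_cancel₀ _ hJ.ne'
    · rw [AlternatingMap.smul_apply, hF.angleFactor_verticalLift x hv, smul_eq_mul]

theorem fiberIntegral_angleForm (x : M) (h : TangentBundle (𝓡 (d + 1)) M → ℝ) :
    fiberIntegral x h (angleForm F x) =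
      sphereVolume d / angleVolume volume (fun w : E d => F ⟨x, w⟩) *
        ∫ s : Metric.sphere (0 : E d) 1,
          h ⟨x, (s : E d)⟩ * polarJacobian (fun w : E d => F ⟨x, w⟩) s ∂volume.toSphere := by
  have hf := hF.isMinkowskiNorm x
  obtain ⟨Ω, hΩ⟩ : ∃ Ω, IsVolumeAngle F x Ω (angleForm F x) :=
    Classical.epsilon_spec (hF.exists_isVolumeAngle x)
  obtain ⟨κ, hκ⟩ := hF.exists_eq_mul_angleDet hΩ
  have htotal : κ * angleVolume volume (fun w : E d => F ⟨x, w⟩) = sphereVolume d := by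
    rw [← hΩ.integral_eq, fiberIntegral_eq_mul hf hκ]
    simp only [one_mul, angleVolume]
  rw [fiberIntegral_eq_mul hf hκ, ← htotal, mul_div_cancel_right₀ _ (hf.angleVolume_pos volume).ne']

theorem isSymbol_finslerLaplacian : IsSymbol (finslerLaplacian F) fun x p =>
    minkowskiSymbol (V := E d) volume (fun u => F ⟨x, u⟩) p := by
  intro x φ hφ hφx
  have hlie (s : Metric.sphere (0 : E d) 1) :
      lieReeb F (lieReeb F (fun q : TangentBundle (𝓡 (d + 1)) M => φ q.1 ^ 2)) ⟨x, (s : E d)⟩ =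
        2 * (fiberwiseDifferential φ ⟨x, (s : E d)⟩ / F ⟨x, (s : E d)⟩) ^ 2 :=
    hF.lieReeb_lieReeb_sq (hφ.of_le (WithTop.coe_le_coe.2 le_top)) hφx
      (Metric.ne_of_mem_sphere s.2 one_ne_zero)
  have hvol := (sphereVolume_pos (d := d)).ne'
  rw [finslerLaplacian, hF.fiberIntegral_angleForm]
  simp only [minkowskiSymbol, finrank_euclideanSpace_fin, hlie, mul_assoc (2 : ℝ),
    integral_const_mul]
  field_simp
  rfl

end IsFinslerMetric

end AngleForm

/-! ### Comparison with the dual norm -/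

theorem IsComparableGauge.of_div {V : Type*} [NormedAddCommGroup V] [NormedSpace ℝ V] {C : ℝ}
    {f N : V → ℝ} (hf : IsMinkowskiNorm f) (hC : 0 < C) (hN : ∀ (c : ℝ) v, N (c • v) = |c| * N v)
    (hfN : ∀ v, v ≠ 0 → C⁻¹ ≤ f v / N v ∧ f v / N v ≤ C) : IsComparableGauge C f N := by
  have hN0 : N 0 = 0 := by simpa using hN 0 0
  have hNpos (v : V) (hv : v ≠ 0) : 0 < N v :=
    (div_pos_iff_of_pos_left (hf.pos v hv)).1 ((inv_pos.2 hC).trans_le (hfN v hv).1)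
  refine ⟨hN, fun v => ?_, fun v => ?_⟩ <;> obtain rfl | hv := eq_or_ne v 0
  · rw [hN0, hf.map_zero, mul_zero]
  · exact (inv_mul_le_iff₀ hC).1 ((le_div_iff₀ (hNpos v hv)).1 (hfN v hv).1)
  · rw [hN0, hf.map_zero, mul_zero]
  · exact (div_le_iff₀ (hNpos v hv)).1 (hfN v hv).2

theorem sqrt_mul_sq_div {a b : ℝ} (hb : 0 < b) : √(a * b ^ 2) / b = √a := by
  rw [Real.sqrt_mul' a (sq_nonneg b), Real.sqrt_sq hb.le, mul_div_cancel_right₀ _ hb.ne']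

theorem exists_one_le_rpow_neg_le_and_le_rpow {C a b : ℝ} (hC : 1 < C) (ha : 0 < a) (hb : 0 < b) :
    ∃ K : ℝ, 1 ≤ K ∧ C ^ (-K) ≤ a ∧ b ≤ C ^ K := by
  refine ⟨max 1 (max (-Real.logb C a) (Real.logb C b)), le_max_left _ _, ?_, ?_⟩
  · exact (Real.le_logb_iff_rpow_le hC ha).1 (neg_le.1 (by simp))
  · exact (Real.logb_le_iff_le_rpow hC hb).1 (by simp)

theorem sqrt_inner_smul (g : Bundle.ContMDiffRiemannianMetric (𝓡 (d + 1)) ∞ (E d)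
    (fun x : M => TangentSpace (𝓡 (d + 1)) x)) (x : M) (c : ℝ) (v : TangentSpace (𝓡 (d + 1)) x) :
    √(g.inner x (c • v) (c • v)) = |c| * √(g.inner x v v) := by
  simp only [map_smul, smul_apply, smul_eq_mul, ← mul_assoc, ← sq]
  rw [Real.sqrt_mul (sq_nonneg c), Real.sqrt_sq_eq_abs]

theorem dualNorm_eq_dualGauge (g : Bundle.ContMDiffRiemannianMetric (𝓡 (d + 1)) ∞ (E d)
    (fun x : M => TangentSpace (𝓡 (d + 1)) x)) (x : M)
    (p : TangentSpace (𝓡 (d + 1)) x →L[ℝ] ℝ) :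
    dualNorm g x p = dualGauge (fun v => √(g.inner x v v)) p := by
  simp only [dualNorm, dualGauge, Real.sqrt_eq_one]

end Finsler

end

theorem proposition3p4_general (d : ℕ) (C : ℝ) (hC : 1 < C) :
    ∃ K : ℝ, 1 ≤ K ∧
      ∀ (M : Type*) [TopologicalSpace M] [ChartedSpace (EuclideanSpace ℝ (Fin (d + 1))) M]
        [IsManifold (𝓡 (d + 1)) ∞ M]
        (F : TangentBundle (𝓡 (d + 1)) M → ℝ)
        (N : ∀ x : M, TangentSpace (𝓡 (d + 1)) x → ℝ),
        Finsler.IsFinslerMetric F →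
        (∀ (x : M) (c : ℝ) (v : TangentSpace (𝓡 (d + 1)) x), N x (c • v) = |c| * N x v) →
        (∀ (x : M) (v : TangentSpace (𝓡 (d + 1)) x), v ≠ 0 →
          C⁻¹ ≤ F ⟨x, v⟩ / N x v ∧ F ⟨x, v⟩ / N x v ≤ C) →
        ∃ σ : ∀ x : M, (TangentSpace (𝓡 (d + 1)) x →L[ℝ] ℝ) → ℝ,
          Finsler.IsSymbol (Finsler.finslerLaplacian F) σ ∧
          ∀ (x : M) (p : TangentSpace (𝓡 (d + 1)) x →L[ℝ] ℝ), p ≠ 0 →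
            C ^ (-K) ≤ √(σ x p) / Finsler.dualGauge (N x) p ∧
              √(σ x p) / Finsler.dualGauge (N x) p ≤ C ^ K := by
  have hC0 : 0 < C := one_pos.trans hC
  set n : ℕ := Module.finrank ℝ (Finsler.E d)
  have hn : 0 < n := Module.finrank_pos
  obtain ⟨K, hK, hlower, hupper⟩ := Finsler.exists_one_le_rpow_neg_le_and_le_rpow hC
    (a := √(n * (C⁻¹ / 2) ^ 2 * (C⁻¹ ^ 4 / 16) ^ n)) (b := √(n * C ^ 2))
    (by positivity) (by positivity)
  refine ⟨K, hK, fun M _ _ _ F N hF hN hFN => ⟨_, hF.isSymbol_finslerLaplacian, fun x p hp => ?_⟩⟩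
  have hf := hF.isMinkowskiNorm x
  have h := Finsler.IsComparableGauge.of_div hf hC0 (hN x) (hFN x)
  have hdual := h.dualGauge_pos hf hC0 hp
  constructor
  · refine (hlower.trans_eq (Finsler.sqrt_mul_sq_div hdual).symm).trans ?_
    exact div_le_div_of_nonneg_right
      (Real.sqrt_le_sqrt (h.le_minkowskiSymbol MeasureTheory.volume hf hC.le hp)) hdual.le
  · refine le_trans ?_ ((Finsler.sqrt_mul_sq_div hdual).trans_le hupper)
    exact div_le_div_of_nonneg_right
      (Real.sqrt_le_sqrt (h.minkowskiSymbol_le MeasureTheory.volume hf hC0 hp)) hdual.le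

theorem proposition3p4 (d : ℕ) (C : ℝ) (hC : 1 < C) :
    ∃ K : ℝ, 1 ≤ K ∧
      ∀ (M : Type*) [TopologicalSpace M] [ChartedSpace (EuclideanSpace ℝ (Fin (d + 1))) M]
        [IsManifold (𝓡 (d + 1)) ∞ M]
        (F : TangentBundle (𝓡 (d + 1)) M → ℝ)
        (g₀ : Bundle.ContMDiffRiemannianMetric (𝓡 (d + 1)) ∞ (EuclideanSpace ℝ (Fin (d + 1)))
          (fun x : M => TangentSpace (𝓡 (d + 1)) x)),
        Finsler.IsFinslerMetric F →
        (∀ (x : M) (v : TangentSpace (𝓡 (d + 1)) x), v ≠ 0 →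
          C⁻¹ ≤ F ⟨x, v⟩ / √(g₀.inner x v v) ∧ F ⟨x, v⟩ / √(g₀.inner x v v) ≤ C) →
        ∃ σ : ∀ x : M, (TangentSpace (𝓡 (d + 1)) x →L[ℝ] ℝ) → ℝ,
          Finsler.IsSymbol (Finsler.finslerLaplacian F) σ ∧
          ∀ (x : M) (p : TangentSpace (𝓡 (d + 1)) x →L[ℝ] ℝ), p ≠ 0 →
            C ^ (-K) ≤ √(σ x p) / Finsler.dualNorm g₀ x p ∧
              √(σ x p) / Finsler.dualNorm g₀ x p ≤ C ^ K := by
  obtain ⟨K, hK, h⟩ := proposition3p4_general d C hC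
  refine ⟨K, hK, fun M _ _ _ F g₀ hF hFg => ?_⟩
  simpa only [Finsler.dualNorm_eq_dualGauge] using
    h M F (fun x v => √(g₀.inner x v v)) hF (Finsler.sqrt_inner_smul g₀) hFg
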